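/- **Theorem 3.1.** Let $\lambda_1,\lambda_2\ge 0$, let $w_1,\dots,w_g>0$, and let the index sets $G_1,\dots,G_g\subseteq\{1,\dots,n\}$ be pairwise disjoint with $\bigcup_{l=1}^g G_l=\{1,\dots,n\}$. For $x\in\mathbb{R}^n$ let $x_{G_l}\in\mathbb{R}^{|G_l|}$ be the restriction of $x$ to $G_l$, let $\mathcal{P}x:=(x_{G_1},\dots,x_{G_g})\in\prod_{l}\mathbb{R}^{|G_l|}$, with adjoint $\mathcal{P}^*$, and put $$\varphi(x):=\lambda_1\|x\|_1,\qquad p(x):=\lambda_1\|x\|_1+\lambda_2\sum_{l=1}^g w_l\|x_{G_l}\|,$$ where $\|\cdot\|$ is the $\ell_2$ norm. For a convex function $f:\mathbb{R}^n\to\mathbb{R}$ let $\operatorname{Prox}_f(u):=\arg\min_x\{f(x)+\tfrac12\|x-u\|^2\}$. Let $\Pi_l$ be the metric projection of $\mathbb{R}^{|G_l|}$ onto the closed $\ell_2$-ball of radius $\lambda_2w_l$ centred at $0$. Let $\partial F(x)$ denote the Clarke generalized Jacobian of a locally Lipschitz map $F$, i.e. the convex hull of all limits $\lim_k F'(x_k)$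 with $x_k\to x$ and $F$ differentiable at every $x_k$. For $u\in\mathbb{R}^n$ define $$\mathcal{M}(u):=\Big\{(I-\mathcal{P}^*\Sigma\mathcal{P})\Theta \;\Big|\; \Sigma=\operatorname{Diag}(\Sigma_1,\dots,\Sigma_g),\ \Sigma_l\in\partial\Pi_l(v_{G_l})\ (1\le l\le g),\ v=\operatorname{Prox}_\varphi(u),\ \Theta\in\partial\operatorname{Prox}_\varphi(u)\Big\}.$$ Then: 1. for every $u\in\mathbb{R}^n$ the set $\mathcal{M}(u)$ is nonempty and compact, and the multifunction $\mathcal{M}$ is upper semicontinuous; 2. for every $u\in\mathbb{R}^n$, every $M\in\mathcal{M}(u)$ is symmetric and positive semidefinite; 3. $\operatorname{Prox}_p$ is strongly semismooth on $\mathbb{R}^n$ with respect to $\mathcal{M}$; that is, $\operatorname{Prox}_p$ is locally Lipschitz, it is directionally differentiable at every point, and for every $u\in\mathbb{R}^n$ there are $C,\delta>0$ such that for all $w\in\mathbb{R}^n$ with $\|w-u\|<\delta$ and all $M\in\mathcal{M}(w)$, $$\|\operatorname{Prox}_p(w)-\operatorname{Prox}_p(u)-M(w-u)\|\le C\,\|w-u\|^2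 .$$ -/

import Mathlib

open Set Filter Topology

/-- The proximal mapping `Prox_p(u) = argmin_x { p x + ‖x - u‖² / 2 }`
(see `prox_spec`: for a convex continuous `p ≥ 0` the minimizer exists and is unique). -/
noncomputable def prox {E : Type*} [NormedAddCommGroup E] (p : E → ℝ) (u : E) : E :=
  Classical.epsilon fun x => IsMinOn (fun y => p y + 1 / 2 * ‖y - u‖ ^ 2) univ x

/-- The metric projection `Π_C(v)`, the point of `C` closest to `v`
(see `metricProj_spec`: for a nonempty closed convex `C` it exists and is unique). -/
noncomputable def metricProj {E : Type*} [NormedAddCommGroup E] (C : Set E) (v : E) : E :=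
  Classical.epsilon fun x => x ∈ C ∧ IsMinOn (fun y => ‖v - y‖) C x

theorem existsUnique_prox {E : Type*} [NormedAddCommGroup E] [InnerProductSpace ℝ E]
    [FiniteDimensional ℝ E] {p : E → ℝ} (hconv : ConvexOn ℝ univ p) (hcont : Continuous p)
    (hp : ∀ x, 0 ≤ p x) (u : E) :
    ∃! x, IsMinOn (fun y => p y + 1 / 2 * ‖y - u‖ ^ 2) univ x := by
  have hproper : ProperSpace E := FiniteDimensional.proper ℝ E
  have hc : Continuous fun y => p y + 1 / 2 * ‖y - u‖ ^ 2 := by fun_prop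
  have hlim : Tendsto (fun y => p y + 1 / 2 * ‖y - u‖ ^ 2) (cocompact E) atTop := by
    have h1 : Tendsto (fun y : E => ‖y - u‖) (cocompact E) atTop := by
      refine tendsto_atTop_mono (fun y => ?_)
        (tendsto_atTop_add_const_right _ (-‖u‖) (tendsto_norm_cocompact_atTop (E := E)))
      have := norm_sub_norm_le y u
      linarith
    have h2 : Tendsto (fun y : E => 1 / 2 * ‖y - u‖ ^ 2) (cocompact E) atTop :=
      ((tendsto_pow_atTop two_ne_zero).comp h1).const_mul_atTop (by norm_num)
    exact tendsto_atTop_mono (fun y => by have := hp y; linarith) h2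
  obtain ⟨x, hx⟩ := hc.exists_forall_le hlim
  refine ⟨x, fun y _ => hx y, fun z hz => ?_⟩
  have hz' : ∀ y, p z + 1 / 2 * ‖z - u‖ ^ 2 ≤ p y + 1 / 2 * ‖y - u‖ ^ 2 := fun y => hz (mem_univ y)
  set m : E := (1 / 2 : ℝ) • x + (1 / 2 : ℝ) • z with hm
  have h1 : p m ≤ 1 / 2 * p x + 1 / 2 * p z := by
    simpa [hm] using hconv.2 (mem_univ x) (mem_univ z) (by norm_num : (0 : ℝ) ≤ 1 / 2)
      (by norm_num : (0 : ℝ) ≤ 1 / 2) (by norm_num)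
  have h2 := parallelogram_law_with_norm ℝ (x - u) (z - u)
  have h3 : (x - u) + (z - u) = (2 : ℝ) • (m - u) := by rw [hm]; module
  have h4 : (x - u) - (z - u) = x - z := by abel
  rw [h3, h4, norm_smul] at h2
  norm_num at h2
  have h5 := hx m
  have h6 := hz' m
  have h7 : ‖x - z‖ ^ 2 ≤ 0 := by nlinarith
  have h8 : ‖x - z‖ = 0 := by
    have := sq_nonneg ‖x - z‖
    exact pow_eq_zero_iff two_ne_zero |>.1 (le_antisymm h7 this)
  exact (sub_eq_zero.1 (norm_eq_zero.1 h8)).symm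

theorem prox_spec {E : Type*} [NormedAddCommGroup E] [InnerProductSpace ℝ E]
    [FiniteDimensional ℝ E] {p : E → ℝ} (hconv : ConvexOn ℝ univ p) (hcont : Continuous p)
    (hp : ∀ x, 0 ≤ p x) (u x : E) :
    x = prox p u ↔ IsMinOn (fun y => p y + 1 / 2 * ‖y - u‖ ^ 2) univ x := by
  have h := existsUnique_prox hconv hcont hp u
  have hs : IsMinOn (fun y => p y + 1 / 2 * ‖y - u‖ ^ 2) univ (prox p u) :=
    Classical.epsilon_spec h.exists
  exact ⟨fun hx => hx ▸ hs, fun hx => h.unique hx hs⟩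

theorem metricProj_spec {E : Type*} [NormedAddCommGroup E] [InnerProductSpace ℝ E]
    [CompleteSpace E] {C : Set E} (hne : C.Nonempty) (hcl : IsClosed C) (hconv : Convex ℝ C)
    (v x : E) :
    x = metricProj C v ↔ x ∈ C ∧ IsMinOn (fun y => ‖v - y‖) C x := by
  have key : ∀ z, z ∈ C ∧ IsMinOn (fun y => ‖v - y‖) C z →
      z ∈ C ∧ ∀ w ∈ C, inner ℝ (v - z) (w - z) ≤ 0 := by
    rintro z ⟨hz, hmin⟩
    refine ⟨hz, (norm_eq_iInf_iff_real_inner_le_zero hconv hz).1 ?_⟩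
    have : Nonempty C := ⟨⟨z, hz⟩⟩
    refine le_antisymm (le_ciInf fun w => hmin w.2) ?_
    exact ciInf_le (f := fun w : C => ‖v - w‖) ⟨0, forall_mem_range.2 fun _ => norm_nonneg _⟩ ⟨z, hz⟩
  have hex : ∃ z, z ∈ C ∧ IsMinOn (fun y => ‖v - y‖) C z := by
    obtain ⟨z, hz, heq⟩ := exists_norm_eq_iInf_of_complete_convex hne hcl.isComplete hconv v
    refine ⟨z, hz, fun w hw => ?_⟩
    change ‖v - z‖ ≤ ‖v - w‖
    rw [heq]
    exact ciInf_le (f := fun w : C => ‖v - w‖) ⟨0, forall_mem_range.2 fun _ => norm_nonneg _⟩ ⟨w, hw⟩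
  have hs : metricProj C v ∈ C ∧ IsMinOn (fun y => ‖v - y‖) C (metricProj C v) :=
    Classical.epsilon_spec hex
  refine ⟨fun hx => hx ▸ hs, fun hx => ?_⟩
  obtain ⟨hx1, hx2⟩ := key x hx
  obtain ⟨hy1, hy2⟩ := key _ hs
  have h1 := hx2 _ hy1
  have h2 := hy2 _ hx1
  set y := metricProj C v
  have h3 : inner ℝ (y - x) (y - x) ≤ 0 := by
    have e : inner ℝ (y - x) (y - x) = inner ℝ (v - x) (y - x) + inner ℝ (v - y) (x - y) := by
      have : y - x = (v - x) - (v - y) := by abel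
      rw [this, inner_sub_left, ← this, ← neg_sub y x, inner_neg_right]
      ring
    linarith
  rw [real_inner_self_nonpos, sub_eq_zero] at h3
  exact h3.symm

/-- The B-subdifferential: limits of derivatives of `F` along sequences of points of
differentiability converging to `x`. -/
def bSubdifferential {E F : Type*} [NormedAddCommGroup E] [NormedSpace ℝ E]
    [NormedAddCommGroup F] [NormedSpace ℝ F] (f : E → F) (x : E) : Set (E →L[ℝ] F) :=
  {A | ∃ z : ℕ → E, Tendsto z atTop (𝓝 x) ∧ (∀ k, DifferentiableAt ℝ f (z k)) ∧
    Tendsto (fun k => fderiv ℝ f (z k)) atTop (𝓝 A)}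

/-- The Clarke generalized Jacobian `∂f(x)`. -/
def clarkeJacobian {E F : Type*} [NormedAddCommGroup E] [NormedSpace ℝ E]
    [NormedAddCommGroup F] [NormedSpace ℝ F] (f : E → F) (x : E) : Set (E →L[ℝ] F) :=
  convexHull ℝ (bSubdifferential f x)

/-- `f` is strongly semismooth (everywhere) with respect to the multifunction `K`: it is locally
Lipschitz, directionally differentiable, and for every `x`,
`f w - f x - V (w - x) = O(‖w - x‖²)` for `V ∈ K w`, `w → x` (uniformly in `V`). -/
def StronglySemismooth {E F : Type*} [NormedAddCommGroup E] [NormedSpace ℝ E]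
    [NormedAddCommGroup F] [NormedSpace ℝ F] (f : E → F) (K : E → Set (E →L[ℝ] F)) : Prop :=
  LocallyLipschitz f ∧
  (∀ x d : E, ∃ f' : F,
    Tendsto (fun t : ℝ => t⁻¹ • (f (x + t • d) - f x)) (𝓝[>] 0) (𝓝 f')) ∧
  ∀ x : E, ∃ C : ℝ, ∃ δ > 0, ∀ w : E, ‖w - x‖ < δ → ∀ V ∈ K w,
    ‖f w - f x - V (w - x)‖ ≤ C * ‖w - x‖ ^ 2

namespace SGLasso

/-- `x ↦ x_s`, the restriction of a vector to the coordinates in `s`. -/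
noncomputable def restr {n : ℕ} (s : Finset (Fin n)) :
    EuclideanSpace ℝ (Fin n) →L[ℝ] EuclideanSpace ℝ s :=
  LinearMap.toContinuousLinearMap
    { toFun := fun x => WithLp.toLp 2 fun i : s => x i
      map_add' := fun _ _ => rfl
      map_smul' := fun _ _ => rfl }

/-- `φ(x) = λ₁ ‖x‖₁`. -/
noncomputable def l1Part {n : ℕ} (lam1 : ℝ) (x : EuclideanSpace ℝ (Fin n)) : ℝ :=
  lam1 * ∑ i, |x i|

/-- The sparse group Lasso regularizer `p(x) = λ₁ ‖x‖₁ + λ₂ ∑ₗ wₗ ‖x_{Gₗ}‖`. -/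
noncomputable def regularizer {n g : ℕ} (G : Fin g → Finset (Fin n)) (lam1 lam2 : ℝ)
    (w : Fin g → ℝ) (x : EuclideanSpace ℝ (Fin n)) : ℝ :=
  l1Part lam1 x + lam2 * ∑ l, w l * ‖restr (G l) x‖

/-- The space `ℝ^s = ∏ₗ ℝ^{|Gₗ|}` with the Euclidean norm. -/
abbrev GroupSpace {n g : ℕ} (G : Fin g → Finset (Fin n)) : Type :=
  PiLp 2 fun l => EuclideanSpace ℝ (G l)

/-- The operator `P x = (x_{G₁}, …, x_{G_g})`. -/
noncomputable def groupMap {n g : ℕ} (G : Fin g → Finset (Fin n)) :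
    EuclideanSpace ℝ (Fin n) →L[ℝ] GroupSpace G :=
  LinearMap.toContinuousLinearMap
    { toFun := fun x => WithLp.toLp 2 fun l => restr (G l) x
      map_add' := fun _ _ => by ext; simp
      map_smul' := fun _ _ => by ext; simp }

/-- The block diagonal operator `Diag(Σ₁, …, Σ_g)`. -/
noncomputable def blockDiag {n g : ℕ} (G : Fin g → Finset (Fin n))
    (S : ∀ l, EuclideanSpace ℝ (G l) →L[ℝ] EuclideanSpace ℝ (G l)) :
    GroupSpace G →L[ℝ] GroupSpace G :=
  LinearMap.toContinuousLinearMap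
    { toFun := fun y => WithLp.toLp 2 fun l => S l (y l)
      map_add' := fun _ _ => by ext; simp
      map_smul' := fun _ _ => by ext; simp }

/-- The multifunction `M(u) = {(I - P* Σ P) Θ}`, where `Σ = Diag(Σ₁, …, Σ_g)`,
`Σₗ ∈ ∂Π_{Bₗ}(v_{Gₗ})` with `Bₗ` the closed `ℓ₂`-ball of radius `λ₂ wₗ`,
`v = Prox_φ(u)` and `Θ ∈ ∂Prox_φ(u)`. -/
noncomputable def surrogateJacobian {n g : ℕ} (G : Fin g → Finset (Fin n)) (lam1 lam2 : ℝ)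
    (w : Fin g → ℝ) (u : EuclideanSpace ℝ (Fin n)) :
    Set (EuclideanSpace ℝ (Fin n) →L[ℝ] EuclideanSpace ℝ (Fin n)) :=
  {M | ∃ S : ∀ l, EuclideanSpace ℝ (G l) →L[ℝ] EuclideanSpace ℝ (G l),
    (∀ l, S l ∈ clarkeJacobian
      (metricProj (Metric.closedBall (0 : EuclideanSpace ℝ (G l)) (lam2 * w l)))
      (restr (G l) (prox (l1Part lam1) u))) ∧
    ∃ Θ ∈ clarkeJacobian (prox (l1Part (n := n) lam1)) u,
      M = (ContinuousLinearMap.id ℝ _ -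
        (ContinuousLinearMap.adjoint (groupMap G)).comp
          ((blockDiag G S).comp (groupMap G))).comp Θ}

theorem regularizer_prox_spec {n g : ℕ} (G : Fin g → Finset (Fin n)) {lam1 lam2 : ℝ}
    {w : Fin g → ℝ} (h1 : 0 ≤ lam1) (h2 : 0 ≤ lam2) (hw : ∀ l, 0 < w l)
    (u x : EuclideanSpace ℝ (Fin n)) :
    x = prox (regularizer G lam1 lam2 w) u ↔
      IsMinOn (fun y => regularizer G lam1 lam2 w y + 1 / 2 * ‖y - u‖ ^ 2) univ x := by
  apply prox_spec
  · refine ⟨convex_univ, fun x _ y _ a b ha hb _ => ?_⟩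
    have e1 : ∑ i, |(a • x + b • y) i| ≤ a * ∑ i, |x i| + b * ∑ i, |y i| := by
      rw [Finset.mul_sum, Finset.mul_sum, ← Finset.sum_add_distrib]
      refine Finset.sum_le_sum fun i _ => ?_
      have := abs_add_le (a * x i) (b * y i)
      rw [abs_mul, abs_mul, abs_of_nonneg ha, abs_of_nonneg hb] at this
      simpa using this
    have e2 : ∑ l, w l * ‖restr (G l) (a • x + b • y)‖ ≤
        a * ∑ l, w l * ‖restr (G l) x‖ + b * ∑ l, w l * ‖restr (G l) y‖ := by
      rw [Finset.mul_sum, Finset.mul_sum, ← Finset.sum_add_distrib]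
      refine Finset.sum_le_sum fun l _ => ?_
      have := norm_add_le (a • restr (G l) x) (b • restr (G l) y)
      rw [norm_smul, norm_smul, Real.norm_of_nonneg ha, Real.norm_of_nonneg hb] at this
      rw [map_add, map_smul, map_smul]
      have := mul_le_mul_of_nonneg_left this (hw l).le
      linarith
    have e3 := mul_le_mul_of_nonneg_left e1 h1
    have e4 := mul_le_mul_of_nonneg_left e2 h2
    simp only [regularizer, l1Part, smul_eq_mul]
    linarith
  · unfold regularizer l1Part
    fun_prop
  · intro x
    have := fun l => (hw l).le
    have h3 : 0 ≤ ∑ l, w l * ‖restr (G l) x‖ :=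
      Finset.sum_nonneg fun l _ => mul_nonneg (this l) (norm_nonneg _)
    unfold regularizer l1Part
    positivity

end SGLasso

/-!
# Strong semismoothness of the sparse group Lasso proximal mapping

Everything reduces to one nonsmooth map, the projection `Π` onto a Euclidean ball of radius `r`.
On each side of the sphere it is smooth (the identity inside, the radial map `z ↦ (r / ‖z‖) z`
outside), and it is not differentiable on the sphere, so its B-subdifferential at `v` is contained
in a set of at most two operators, `ballJacobian r v`, built from the identity and `v ⊗ v`. This
gives compactness of the Clarke Jacobian (hull of a finite set), the spectral bound `Σ ≤ I`, and the
second-order estimate `quadraticModelAt_ballProj`, whose heart is the explicit error formula in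
`norm_radial_error_le`. An error bound is convex in the operator, so it passes to convex hulls.

Soft thresholding, the proximal mapping of `φ`, is `t ↦ t - Π t` in each coordinate, with `Π` the
projection of the line onto `[-λ₁, λ₁]`; hence its generalized derivatives `Θ` are diagonal with
nonnegative entries, equal to `1` on the coordinates that survive. The group part has the proximal
mapping `v ↦ v - P* Π(P v)` with `Π` acting blockwise, and `prox_regularizer` shows that `Prox_p` is
the composition of the two. Second-order estimates and directional derivatives of Lipschitz maps
obey a chain rule (`QuadraticModelAt.comp`, `DirDifferentiable.comp`), which yields strong
semismoothness.

Upper semicontinuity holds because `M` is the continuous image of Clarke Jacobians of Lipschitz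
maps, which are uniformly bounded and have closed graph. For positivity, `I - P* Σ P` commutes with every
diagonal operator fixing `v = Prox_φ(u)`, in particular with `√Θ`, so that
`(I - P* Σ P) Θ = √Θ (I - P* Σ P) √Θ`.
-/

/-! ### Clarke generalized Jacobians of Lipschitz maps -/

section Clarke

variable {E F : Type*} [NormedAddCommGroup E] [NormedSpace ℝ E]
  [NormedAddCommGroup F] [NormedSpace ℝ F]

/-- Membership in the B-subdifferential is a closure condition in the product space, so its graph
is closed: a closed condition on `(z, f' z)` at the points of differentiability is inherited by
`(x, A)` for every `A` in the B-subdifferential at `x`. -/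
theorem mem_bSubdifferential_iff {f : E → F} {x : E} {A : E →L[ℝ] F} :
    A ∈ bSubdifferential f x ↔
      (x, A) ∈ closure {p : E × (E →L[ℝ] F) | DifferentiableAt ℝ f p.1 ∧ p.2 = fderiv ℝ f p.1} := by
  rw [mem_closure_iff_seq_limit]
  constructor
  · rintro ⟨z, hz, hd, hA⟩
    exact ⟨fun k => (z k, fderiv ℝ f (z k)), fun k => ⟨hd k, rfl⟩, hz.prodMk_nhds hA⟩
  · rintro ⟨p, hp, hlim⟩
    refine ⟨fun k => (p k).1, ?_, fun k => (hp k).1, ?_⟩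
    · exact (continuous_fst.tendsto _).comp hlim
    · simp_rw [← fun k => (hp k).2]
      exact (continuous_snd.tendsto _).comp hlim

theorem bSubdifferential_mem_of_isClosed {f : E → F} {T : Set (E × (E →L[ℝ] F))}
    (hT : IsClosed T) (h : ∀ z, DifferentiableAt ℝ f z → (z, fderiv ℝ f z) ∈ T) {x : E}
    {A : E →L[ℝ] F} (hA : A ∈ bSubdifferential f x) : (x, A) ∈ T := by
  refine closure_minimal ?_ hT (mem_bSubdifferential_iff.1 hA)
  rintro ⟨z, B⟩ ⟨hz, hB⟩
  have hB' : B = fderiv ℝ f z := hB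
  exact hB' ▸ h z hz

theorem bSubdifferential_subset_closedBall {f : E → F} {K : NNReal} (hf : LipschitzWith K f)
    (x : E) : bSubdifferential f x ⊆ Metric.closedBall 0 K := by
  intro A hA
  have hT : IsClosed {p : E × (E →L[ℝ] F) | ‖p.2‖ ≤ K} :=
    isClosed_le (by fun_prop) (by fun_prop)
  have := bSubdifferential_mem_of_isClosed hT
    (fun z _ => norm_fderiv_le_of_lipschitz ℝ hf) hA
  simpa using this

theorem clarkeJacobian_subset_closedBall {f : E → F} {K : NNReal} (hf : LipschitzWith K f)
    (x : E) : clarkeJacobian f x ⊆ Metric.closedBall 0 K :=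
  convexHull_min (bSubdifferential_subset_closedBall hf x) (convex_closedBall _ _)

variable [FiniteDimensional ℝ E] [FiniteDimensional ℝ F]

/-- By Rademacher's theorem the points of differentiability are dense, and the derivatives there
stay in a compact ball. -/
theorem bSubdifferential_nonempty {f : E → F} {K : NNReal} (hf : LipschitzWith K f) (x : E) :
    (bSubdifferential f x).Nonempty := by
  have : ProperSpace (E →L[ℝ] F) := FiniteDimensional.proper ℝ _
  have hdense : Dense {z | DifferentiableAt ℝ f z} := by
    borelize E
    exact MeasureTheory.Measure.dense_of_ae
      (hf.ae_differentiableAt (μ := MeasureTheory.Measure.addHaar))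
  obtain ⟨z, hz, hlim⟩ := mem_closure_iff_seq_limit.1 (hdense x)
  obtain ⟨A, -, φ, hφ, hA⟩ := (isCompact_closedBall (0 : E →L[ℝ] F) K).tendsto_subseq
    (x := fun k => fderiv ℝ f (z k))
    (fun k => by simpa using norm_fderiv_le_of_lipschitz ℝ hf)
  exact ⟨A, z ∘ φ, hlim.comp hφ.tendsto_atTop, fun k => hz (φ k), hA⟩

theorem upperHemicontinuous_bSubdifferential {f : E → F} {K : NNReal} (hf : LipschitzWith K f) :
    UpperHemicontinuous (bSubdifferential f) := by
  have : ProperSpace (E →L[ℝ] F) := FiniteDimensional.proper ℝ _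
  intro x
  refine UpperHemicontinuousAt.of_sequences
    (isCompact_closedBall (0 : E →L[ℝ] F) K).isSeqCompact
    (Eventually.of_forall fun z => bSubdifferential_subset_closedBall hf z) ?_
  intro z hz A hA B hB
  rw [mem_bSubdifferential_iff]
  exact isClosed_closure.mem_of_tendsto (hz.prodMk_nhds hB)
    (Eventually.of_forall fun k => mem_bSubdifferential_iff.1 (hA k))

theorem upperHemicontinuous_clarkeJacobian {f : E → F} {K : NNReal} (hf : LipschitzWith K f)
    (hc : ∀ x, IsCompact (clarkeJacobian f x)) : UpperHemicontinuous (clarkeJacobian f) := by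
  rw [upperHemicontinuous_iff_forall_isOpen]
  intro x U hU hxU
  obtain ⟨δ, hδ, hsub⟩ := (hc x).exists_thickening_subset_open hU hxU
  have h1 : bSubdifferential f x ⊆ Metric.thickening δ (clarkeJacobian f x) :=
    (subset_convexHull ℝ _).trans (Metric.self_subset_thickening hδ _)
  filter_upwards [(upperHemicontinuous_iff_forall_isOpen.1
    (upperHemicontinuous_bSubdifferential hf)) x _ Metric.isOpen_thickening h1] with z hz
  -- a thickening of a convex set is convex, so it absorbs the whole hull
  exact (convexHull_min hz ((convex_convexHull ℝ _).thickening δ)).trans hsub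

end Clarke

/-- Images under a continuous map of a correspondence with closed graph and values in a fixed
compact set are upper hemicontinuous. -/
theorem upperHemicontinuous_image {X Y Z : Type*} [TopologicalSpace X] [FirstCountableTopology X]
    [TopologicalSpace Y] [FirstCountableTopology Y] [TopologicalSpace Z]
    [FirstCountableTopology Z] [T2Space Z]
    {K : X → Set Y} {C : Set Y} (hC : IsCompact C) (hKC : ∀ x, K x ⊆ C)
    (hK : ∀ (x : ℕ → X) (x₀ : X), Tendsto x atTop (𝓝 x₀) →
      ∀ y : ℕ → Y, (∀ k, y k ∈ K (x k)) → ∀ y₀, Tendsto y atTop (𝓝 y₀) → y₀ ∈ K x₀)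
    {T : Y → Z} (hT : Continuous T) : UpperHemicontinuous fun x => T '' K x := by
  intro x₀
  refine UpperHemicontinuousAt.of_sequences (hC.image hT).isSeqCompact
    (Eventually.of_forall fun x => image_mono (hKC x)) ?_
  intro x hx z hz z₀ hz₀
  choose y hy hyz using hz
  obtain ⟨y₀, -, φ, hφ, hlim⟩ := hC.tendsto_subseq fun k => hKC _ (hy k)
  refine ⟨y₀, hK (x ∘ φ) x₀ (hx.comp hφ.tendsto_atTop) (y ∘ φ) (fun k => hy (φ k)) y₀ hlim, ?_⟩
  refine tendsto_nhds_unique ((hT.tendsto y₀).comp hlim) ?_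
  have : T ∘ y ∘ φ = z ∘ φ := by
    funext k
    exact hyz (φ k)
  rw [this]
  exact hz₀.comp hφ.tendsto_atTop

/-! ### Second-order models and directional derivatives -/

section Models

variable {E F H : Type*} [NormedAddCommGroup E] [NormedSpace ℝ E]
  [NormedAddCommGroup F] [NormedSpace ℝ F] [NormedAddCommGroup H] [NormedSpace ℝ H]

/-- The operators `V ∈ K w` predict `f w - f x` up to an error `O(‖w - x‖²)` as `w → x`, uniformly
in `V`. -/
def QuadraticModelAt (f : E → F) (K : E → Set (E →L[ℝ] F)) (x : E) : Prop :=
  ∃ C : ℝ, ∀ᶠ w in 𝓝 x, ∀ V ∈ K w, ‖f w - f x - V (w - x)‖ ≤ C * ‖w - x‖ ^ 2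

theorem QuadraticModelAt.mono {f : E → F} {K L : E → Set (E →L[ℝ] F)} {x : E}
    (h : QuadraticModelAt f K x) (hLK : ∀ w, L w ⊆ K w) : QuadraticModelAt f L x := by
  obtain ⟨C, hC⟩ := h
  exact ⟨C, hC.mono fun w hw V hV => hw V (hLK w hV)⟩

/-- The error bound is a convex condition on `V`, so it passes to the Clarke Jacobian. -/
theorem QuadraticModelAt.clarkeJacobian {f : E → F} {x : E}
    (h : QuadraticModelAt f (bSubdifferential f) x) :
    QuadraticModelAt f (clarkeJacobian f) x := by
  obtain ⟨C, hC⟩ := h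
  refine ⟨C, hC.mono fun w hw => ?_⟩
  have hconv : Convex ℝ {V : E →L[ℝ] F | ‖f w - f x - V (w - x)‖ ≤ C * ‖w - x‖ ^ 2} := by
    have : {V : E →L[ℝ] F | ‖f w - f x - V (w - x)‖ ≤ C * ‖w - x‖ ^ 2} =
        (ContinuousLinearMap.apply ℝ F (w - x)) ⁻¹'
          (Metric.closedBall (f w - f x) (C * ‖w - x‖ ^ 2)) := by
      ext V
      simp [dist_eq_norm, norm_sub_rev]
    rw [this]
    exact (convex_closedBall _ _).linear_preimage
      (ContinuousLinearMap.apply ℝ F (w - x)).toLinearMap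
  exact fun V hV => convexHull_min hw hconv hV

theorem QuadraticModelAt.comp {f : E → F} {g : F → H} {K : E → Set (E →L[ℝ] F)}
    {L : F → Set (F →L[ℝ] H)} {x : E} {κ : NNReal} {B : ℝ} (hf : LipschitzWith κ f)
    (hB : ∀ y, ∀ V ∈ L y, ‖V‖ ≤ B)
    (h1 : QuadraticModelAt f K x) (h2 : QuadraticModelAt g L (f x)) :
    QuadraticModelAt (g ∘ f)
      (fun w => {M | ∃ V ∈ L (f w), ∃ Θ ∈ K w, M = V.comp Θ}) x := by
  obtain ⟨C1, hC1⟩ := h1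
  obtain ⟨C2, hC2⟩ := h2
  refine ⟨|C2| * κ ^ 2 + |B| * C1, ?_⟩
  filter_upwards [hC1, hf.continuous.continuousAt.eventually hC2] with w hw1 hw2
  rintro _ ⟨V, hV, Θ, hΘ, rfl⟩
  have e : (g ∘ f) w - (g ∘ f) x - (V.comp Θ) (w - x) =
      (g (f w) - g (f x) - V (f w - f x)) + V (f w - f x - Θ (w - x)) := by
    simp only [Function.comp, ContinuousLinearMap.comp_apply, map_sub]
    abel
  have b1 := hw2 V hV
  have b2 := (V.le_opNorm (f w - f x - Θ (w - x))).trans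
    (mul_le_mul ((hB _ V hV).trans (le_abs_self B)) (hw1 Θ hΘ) (norm_nonneg _) (abs_nonneg B))
  have b3 : ‖f w - f x‖ ≤ κ * ‖w - x‖ := by
    simpa [dist_eq_norm] using hf.dist_le_mul w x
  have b4 : ‖f w - f x‖ ^ 2 ≤ (κ * ‖w - x‖) ^ 2 := by gcongr
  have b5 : C2 * ‖f w - f x‖ ^ 2 ≤ |C2| * (κ * ‖w - x‖) ^ 2 :=
    mul_le_mul (le_abs_self _) b4 (by positivity) (abs_nonneg _)
  rw [e]
  refine (norm_add_le _ _).trans ?_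
  nlinarith

/-- `f` has one-sided directional derivatives at every point in every direction. -/
def DirDifferentiable (f : E → F) : Prop :=
  ∀ x d : E, ∃ f' : F, Tendsto (fun t : ℝ => t⁻¹ • (f (x + t • d) - f x)) (𝓝[>] 0) (𝓝 f')

/-- For a Lipschitz outer map the directional derivatives are Hadamard derivatives, whence a chain
rule. -/
theorem DirDifferentiable.comp {f : E → F} {g : F → H} {κ : NNReal} (hg : LipschitzWith κ g)
    (h2 : DirDifferentiable g) (h1 : DirDifferentiable f) : DirDifferentiable (g ∘ f) := by
  intro x d
  obtain ⟨f', hf'⟩ := h1 x d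
  obtain ⟨g', hg'⟩ := h2 (f x) f'
  refine ⟨g', ?_⟩
  have hsmall : Tendsto (fun t : ℝ => t⁻¹ • (g (f (x + t • d)) - g (f x + t • f')))
      (𝓝[>] 0) (𝓝 0) := by
    have h3 : Tendsto (fun t : ℝ => κ * ‖t⁻¹ • (f (x + t • d) - f x) - f'‖) (𝓝[>] 0) (𝓝 0) := by
      have := (tendsto_iff_norm_sub_tendsto_zero.1 hf').const_mul (κ : ℝ)
      simpa using this
    refine squeeze_zero_norm' ?_ h3
    filter_upwards [self_mem_nhdsWithin] with t (ht : 0 < t)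
    have b := hg.dist_le_mul (f (x + t • d)) (f x + t • f')
    rw [dist_eq_norm, dist_eq_norm] at b
    have e : t⁻¹ • (f (x + t • d) - f x) - f' = t⁻¹ • (f (x + t • d) - (f x + t • f')) := by
      rw [← sub_sub, smul_sub t⁻¹ (f (x + t • d) - f x), smul_smul, inv_mul_cancel₀ ht.ne',
        one_smul]
    rw [e, norm_smul, norm_smul, mul_left_comm]
    gcongr
  have := hg'.add hsmall
  rw [add_zero] at this
  refine this.congr fun t => ?_
  rw [← smul_add]
  simp

theorem DirDifferentiable.id_sub {f : E → E} (h : DirDifferentiable f) :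
    DirDifferentiable fun x => x - f x := by
  intro x d
  obtain ⟨f', hf'⟩ := h x d
  refine ⟨d - f', (tendsto_const_nhds.sub hf').congr' ?_⟩
  filter_upwards [self_mem_nhdsWithin] with t (ht : 0 < t)
  match_scalars <;> field_simp
  ring

end Models

/-! ### Maps assembled from blocks -/

section Blocks

variable {ι : Type*} [Fintype ι] {E : Type*} [NormedAddCommGroup E] [NormedSpace ℝ E]
  {β : ι → Type*} [∀ i, NormedAddCommGroup (β i)] [∀ i, NormedSpace ℝ (β i)]

theorem norm_le_sum_norm {ι : Type*} [Fintype ι] {β : ι → Type*}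
    [∀ i, NormedAddCommGroup (β i)] (x : PiLp 2 β) : ‖x‖ ≤ ∑ i, ‖x i‖ := by
  refine le_of_sq_le_sq ?_ (Finset.sum_nonneg fun i _ => norm_nonneg _)
  rw [PiLp.norm_sq_eq_of_L2]
  exact Finset.sum_sq_le_sq_sum_of_nonneg fun i _ => norm_nonneg _

theorem norm_block_error_le {f : ∀ i, β i → β i} {L : ∀ i, E →L[ℝ] β i}
    {K : ∀ i, β i → Set (β i →L[ℝ] β i)} {x : E}
    (h : ∀ i, QuadraticModelAt (f i) (K i) (L i x)) :
    ∃ C : ℝ, ∀ᶠ w in 𝓝 x, ∀ V : ∀ i, β i →L[ℝ] β i, (∀ i, V i ∈ K i (L i w)) →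
      ‖(WithLp.toLp 2 fun i => f i (L i w) - f i (L i x) - V i (L i (w - x)) : PiLp 2 β)‖ ≤
        C * ‖w - x‖ ^ 2 := by
  choose C hC using h
  refine ⟨∑ i, |C i| * ‖L i‖ ^ 2, ?_⟩
  have : ∀ᶠ w in 𝓝 x, ∀ i, ∀ V ∈ K i (L i w),
      ‖f i (L i w) - f i (L i x) - V (L i w - L i x)‖ ≤ C i * ‖L i w - L i x‖ ^ 2 :=
    eventually_all.2 fun i => (L i).continuous.continuousAt.eventually (hC i)
  filter_upwards [this] with w hw V hV
  refine (norm_le_sum_norm _).trans ?_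
  rw [Finset.sum_mul]
  refine Finset.sum_le_sum fun i _ => ?_
  have b := hw i (V i) (hV i)
  rw [← map_sub (L i)] at b
  refine b.trans ?_
  rw [mul_assoc, ← mul_pow]
  gcongr
  · exact le_abs_self _
  · exact (L i).le_opNorm _

theorem dirDifferentiable_block {f : ∀ i, β i → β i} {L : ∀ i, E →L[ℝ] β i}
    (h : ∀ i, DirDifferentiable (f i)) :
    DirDifferentiable fun x => (WithLp.toLp 2 fun i => f i (L i x) : PiLp 2 β) := by
  intro x d
  choose f' hf' using fun i => h i (L i x) (L i d)
  refine ⟨WithLp.toLp 2 f', ?_⟩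
  have h1 : Tendsto (fun t : ℝ => fun i => t⁻¹ • (f i (L i x + t • L i d) - f i (L i x)))
      (𝓝[>] 0) (𝓝 f') := tendsto_pi_nhds.2 hf'
  refine (((PiLp.continuous_toLp 2 β).tendsto f').comp h1).congr fun t => ?_
  ext i
  simp

end Blocks

/-! ### The projection onto a Euclidean ball -/

section Ball

variable {E : Type*} [NormedAddCommGroup E] [InnerProductSpace ℝ E]

/-- The projection onto the closed ball of radius `r` centred at `0`, in closed form. -/
noncomputable def ballProj (r : ℝ) (v : E) : E :=
  if ‖v‖ ≤ r then v else (r / ‖v‖) • v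

/-- The derivative at `v ≠ 0` of the radial map `z ↦ (r / ‖z‖) z`. -/
noncomputable def radialDeriv (r : ℝ) (v : E) : E →L[ℝ] E :=
  (r / ‖v‖) • (ContinuousLinearMap.id ℝ E - (‖v‖ ^ 2)⁻¹ • InnerProductSpace.rankOne ℝ v v)

/-- The limiting derivatives of `ballProj r` at `v`: the identity on the ball of positive radius,
the derivative of the radial map outside its interior. On the sphere both are present. -/
def ballJacobian (r : ℝ) (v : E) : Set (E →L[ℝ] E) :=
  {V | (V = ContinuousLinearMap.id ℝ E ∧ 0 < r ∧ ‖v‖ ≤ r) ∨ (V = radialDeriv r v ∧ r ≤ ‖v‖)}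

theorem ballProj_of_le {r : ℝ} {v : E} (h : ‖v‖ ≤ r) : ballProj r v = v := if_pos h

theorem ballProj_of_ge {r : ℝ} (hr : 0 ≤ r) {v : E} (h : r ≤ ‖v‖) :
    ballProj r v = (r / ‖v‖) • v := by
  rcases h.lt_or_eq with h | h
  · exact if_neg (not_le.2 h)
  · rw [ballProj_of_le h.ge, ← h]
    rcases hr.lt_or_eq with hr | hr
    · rw [div_self hr.ne', one_smul]
    · have : v = 0 := norm_eq_zero.1 (h.symm.trans hr.symm)
      simp [this]

theorem ballProj_zero_radius (v : E) : ballProj 0 v = 0 := by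
  rw [ballProj_of_ge le_rfl (norm_nonneg v)]
  simp

theorem radialDeriv_zero_radius (v : E) : radialDeriv 0 v = 0 := by
  simp [radialDeriv]

theorem radialDeriv_apply (r : ℝ) (v h : E) :
    radialDeriv r v h = (r / ‖v‖) • (h - (‖v‖ ^ 2)⁻¹ • inner ℝ v h • v) := by
  simp [radialDeriv, InnerProductSpace.rankOne_apply]

theorem norm_ballProj_le {r : ℝ} (hr : 0 ≤ r) (v : E) : ‖ballProj r v‖ ≤ r := by
  rcases le_total ‖v‖ r with h | h
  · rwa [ballProj_of_le h]
  · rw [ballProj_of_ge hr h, norm_smul, Real.norm_of_nonneg (by positivity)]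
    rcases (norm_nonneg v).eq_or_lt with hv | hv
    · simpa [← hv] using hr
    · rw [div_mul_cancel₀ _ hv.ne']

theorem exists_sub_ballProj_eq_smul {r : ℝ} (hr : 0 ≤ r) (v : E) :
    ∃ c : ℝ, 0 ≤ c ∧ v - ballProj r v = c • v := by
  rcases le_total ‖v‖ r with h | h
  · exact ⟨0, le_rfl, by simp [ballProj_of_le h]⟩
  · refine ⟨1 - r / ‖v‖, ?_, ?_⟩
    · linarith [div_le_one_of_le₀ h (norm_nonneg v)]
    · rw [ballProj_of_ge hr h, sub_smul, one_smul]

/-- `ballProj r v` maximizes the linear functional `⟪·, v - ballProj r v⟫` over the ball; in the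
language of convex analysis, it is a subgradient of `r ‖·‖` at `v - ballProj r v`. -/
theorem inner_ballProj_sub {r : ℝ} (hr : 0 ≤ r) (v : E) :
    inner ℝ (ballProj r v) (v - ballProj r v) = r * ‖v - ballProj r v‖ := by
  rcases le_total ‖v‖ r with h | h
  · simp [ballProj_of_le h]
  · rcases eq_or_ne v 0 with rfl | hv
    · simp [ballProj]
    have hv' : 0 < ‖v‖ := norm_pos_iff.2 hv
    have e : v - (r / ‖v‖) • v = (1 - r / ‖v‖) • v := by rw [sub_smul, one_smul]
    have h1 : 0 ≤ 1 - r / ‖v‖ := by linarith [div_le_one_of_le₀ h (norm_nonneg v)]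
    rw [ballProj_of_ge hr h, e, inner_smul_left, inner_smul_right, norm_smul,
      Real.norm_of_nonneg h1, real_inner_self_eq_norm_sq]
    simp only [conj_trivial]
    field_simp

theorem inner_sub_ballProj_nonpos {r : ℝ} (hr : 0 ≤ r) (v : E) {y : E} (hy : ‖y‖ ≤ r) :
    inner ℝ (v - ballProj r v) (y - ballProj r v) ≤ 0 := by
  rw [inner_sub_right, real_inner_comm (ballProj r v), inner_ballProj_sub hr]
  have := real_inner_le_norm (v - ballProj r v) y
  have h2 : ‖v - ballProj r v‖ * ‖y‖ ≤ ‖v - ballProj r v‖ * r := by gcongr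
  linarith

/-- The projection is firmly nonexpansive. -/
theorem norm_ballProj_sub_sq_le {r : ℝ} (hr : 0 ≤ r) (v w : E) :
    ‖ballProj r v - ballProj r w‖ ^ 2 ≤ inner ℝ (v - w) (ballProj r v - ballProj r w) := by
  have h1 := inner_sub_ballProj_nonpos hr v (norm_ballProj_le hr w)
  have h2 := inner_sub_ballProj_nonpos hr w (norm_ballProj_le hr v)
  set p := ballProj r v
  set q := ballProj r w
  have e : inner ℝ (v - w) (p - q) - inner ℝ (p - q) (p - q) =
      -(inner ℝ (v - p) (q - p) + inner ℝ (w - q) (p - q)) := by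
    rw [← inner_sub_left, ← neg_sub p q, inner_neg_right, ← sub_eq_neg_add,
      ← neg_sub (inner ℝ (v - p) (p - q)), neg_neg, ← inner_sub_left]
    congr 1
    abel
  rw [← real_inner_self_eq_norm_sq]
  linarith

theorem norm_ballProj_sub_le {r : ℝ} (hr : 0 ≤ r) (v w : E) :
    ‖ballProj r v - ballProj r w‖ ≤ ‖v - w‖ := by
  have h1 := norm_ballProj_sub_sq_le hr v w
  have h2 := real_inner_le_norm (v - w) (ballProj r v - ballProj r w)
  by_contra! h
  nlinarith [norm_nonneg (v - w), norm_nonneg (ballProj r v - ballProj r w)]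

theorem lipschitzWith_ballProj {r : ℝ} (hr : 0 ≤ r) :
    LipschitzWith 1 (ballProj r : E → E) :=
  LipschitzWith.of_dist_le_mul fun v w => by
    simpa [dist_eq_norm] using norm_ballProj_sub_le hr v w

theorem norm_sub_ballProj_sub_le {r : ℝ} (hr : 0 ≤ r) (v w : E) :
    ‖(v - ballProj r v) - (w - ballProj r w)‖ ≤ ‖v - w‖ := by
  refine le_of_sq_le_sq ?_ (norm_nonneg _)
  have e : (v - ballProj r v) - (w - ballProj r w) =
    (v - w) - (ballProj r v - ballProj r w) := by abel
  rw [e, norm_sub_sq_real]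
  nlinarith [norm_ballProj_sub_sq_le hr v w, sq_nonneg ‖ballProj r v - ballProj r w‖]

theorem metricProj_closedBall [CompleteSpace E] {r : ℝ} (hr : 0 ≤ r) :
    metricProj (Metric.closedBall (0 : E) r) = ballProj r := by
  funext v
  symm
  rw [metricProj_spec ⟨0, by simpa using hr⟩ Metric.isClosed_closedBall (convex_closedBall _ _)]
  refine ⟨by simpa using norm_ballProj_le hr v, fun y hy => ?_⟩
  have h := inner_sub_ballProj_nonpos hr v (y := y) (by simpa using hy)
  have e : v - y = (v - ballProj r v) - (y - ballProj r v) := by abel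
  refine le_of_sq_le_sq ?_ (norm_nonneg (v - y))
  change ‖v - ballProj r v‖ ^ 2 ≤ ‖v - y‖ ^ 2
  rw [e, norm_sub_sq_real (v - ballProj r v)]
  nlinarith [sq_nonneg ‖y - ballProj r v‖]

/-! ### Differentiability of the ball projection -/

/-- Second-order error of the radial map. With the unit vectors `e = z / ‖z‖`, `f = x / ‖x‖` the
error equals `r ((‖x‖ / ‖z‖ - 1) (f - ⟪e, f⟫ e) + (1 - ⟪e, f⟫) e)`, and both terms are quadratic
in `z - x`. -/
theorem norm_radial_error_le {r : ℝ} (hr : 0 ≤ r) {z x : E} (hz : z ≠ 0) (hx : x ≠ 0) :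
    ‖(r / ‖z‖) • z - (r / ‖x‖) • x - radialDeriv r z (z - x)‖ ≤
      4 * r / ‖z‖ ^ 2 * ‖z - x‖ ^ 2 := by
  have ha : 0 < ‖z‖ := norm_pos_iff.2 hz
  have hb : 0 < ‖x‖ := norm_pos_iff.2 hx
  have hab : |‖x‖ - ‖z‖| ≤ ‖z - x‖ := by
    rw [norm_sub_rev]
    exact abs_norm_sub_norm_le x z
  set a := ‖z‖ with ha_def
  set b := ‖x‖ with hb_def
  set D := ‖z - x‖ with hD
  set e : E := a⁻¹ • z with he
  set f : E := b⁻¹ • x with hf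
  have ze : z = a • e := by rw [he, smul_smul, mul_inv_cancel₀ ha.ne', one_smul]
  have xf : x = b • f := by rw [hf, smul_smul, mul_inv_cancel₀ hb.ne', one_smul]
  have ne : ‖e‖ = 1 := by rw [he, norm_smul, norm_inv, norm_norm, inv_mul_cancel₀ ha.ne']
  have nf : ‖f‖ = 1 := by rw [hf, norm_smul, norm_inv, norm_norm, inv_mul_cancel₀ hb.ne']
  clear_value e f
  set c : ℝ := inner ℝ e f with hc
  have hin : inner ℝ z (z - x) = a * (a - b * c) := by
    rw [inner_sub_right, real_inner_self_eq_norm_sq, ← ha_def, ze, xf, inner_smul_left,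
      inner_smul_right, ← hc]
    simp only [conj_trivial]
    ring
  have key : (r / a) • z - (r / b) • x - radialDeriv r z (z - x) =
      r • ((b / a - 1) • (f - c • e) + (1 - c) • e) := by
    rw [radialDeriv_apply, hin, ← ha_def, ze, xf]
    match_scalars <;> field_simp <;> ring
  have nfe : ‖f - e‖ ≤ 2 * D / a := by
    have e1 : f - e = a⁻¹ • ((a - b) • f + (x - z)) := by
      rw [ze, xf]
      match_scalars <;> field_simp
      ring
    rw [e1, norm_smul, Real.norm_of_nonneg (by positivity)]
    have h1 := norm_add_le ((a - b) • f) (x - z)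
    rw [norm_smul, nf, mul_one, Real.norm_eq_abs, abs_sub_comm, norm_sub_rev x z] at h1
    rw [div_eq_inv_mul]
    gcongr
    linarith
  have hc2 : 1 - c = ‖f - e‖ ^ 2 / 2 := by
    rw [norm_sub_sq_real, ne, nf, real_inner_comm, ← hc]
    ring
  have hp : ‖f - c • e‖ ≤ ‖f - e‖ := by
    refine le_of_sq_le_sq ?_ (norm_nonneg _)
    rw [norm_sub_sq_real, norm_sub_sq_real, norm_smul, ne, nf, inner_smul_right,
      real_inner_comm e f, ← hc, Real.norm_eq_abs, mul_one, sq_abs]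
    nlinarith [sq_nonneg (1 - c)]
  have h1 : |b / a - 1| ≤ D / a := by
    have : b / a - 1 = (b - a) / a := by field_simp
    rw [this, abs_div, abs_of_pos ha]
    gcongr
  have h2 : ‖(b / a - 1) • (f - c • e)‖ ≤ D / a * (2 * D / a) := by
    rw [norm_smul, Real.norm_eq_abs]
    exact mul_le_mul h1 (hp.trans nfe) (norm_nonneg _) (by positivity)
  have h3 : ‖(1 - c) • e‖ ≤ (2 * D / a) ^ 2 / 2 := by
    rw [norm_smul, ne, mul_one, hc2, Real.norm_of_nonneg (by positivity)]
    gcongr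
  rw [key, norm_smul, Real.norm_of_nonneg hr]
  calc r * ‖(b / a - 1) • (f - c • e) + (1 - c) • e‖
      ≤ r * (D / a * (2 * D / a) + (2 * D / a) ^ 2 / 2) := by
        gcongr
        exact (norm_add_le _ _).trans (add_le_add h2 h3)
    _ = 4 * r / a ^ 2 * D ^ 2 := by
        field_simp
        ring

theorem hasFDerivAt_radial {r : ℝ} (hr : 0 ≤ r) {v : E} (hv : v ≠ 0) :
    HasFDerivAt (fun z : E => (r / ‖z‖) • z) (radialDeriv r v) v := by
  have h1 : (fun x : E => (r / ‖x‖) • x - (r / ‖v‖) • v - radialDeriv r v (x - v))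
      =O[𝓝 v] fun x => ‖x - v‖ ^ 2 := by
    refine Asymptotics.IsBigO.of_bound (4 * r / ‖v‖ ^ 2) ?_
    filter_upwards [isOpen_ne.mem_nhds hv] with x hx
    have := norm_radial_error_le hr hv hx
    rw [norm_pow, norm_norm, norm_sub_rev x v]
    refine le_of_eq_of_le ?_ this
    rw [← norm_neg, ← neg_sub x v, map_neg]
    congr 1
    abel
  rw [hasFDerivAt_iff_isLittleO]
  refine h1.trans_isLittleO ?_
  have h2 : Tendsto (fun x : E => x - v) (𝓝 v) (𝓝 0) := by
    have : Continuous fun x : E => x - v := by fun_prop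
    simpa using this.tendsto v
  have := (Asymptotics.isLittleO_norm_pow_id (E' := E) one_lt_two).comp_tendsto h2
  exact this

/-- On the sphere the one-sided radial derivatives of the projection are `z` (inwards) and `0`
(outwards), so the projection is not differentiable there. -/
theorem not_hasFDerivAt_ballProj_of_norm_eq {r : ℝ} (hr : 0 < r) {z : E} (hz : ‖z‖ = r)
    {V : E →L[ℝ] E} : ¬ HasFDerivAt (ballProj r) V z := by
  intro h
  have hline : HasDerivAt (fun t : ℝ => t • z) z 1 := by
    simpa using (hasDerivAt_id (1 : ℝ)).smul_const z
  have h' : HasFDerivAt (ballProj r) V ((1 : ℝ) • z) := by rwa [one_smul]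
  have hcomp : HasDerivAt (fun t : ℝ => ballProj r (t • z)) (V z) 1 :=
    (h'.comp_hasDerivAt (1 : ℝ) hline :)
  have hin : HasDerivWithinAt (fun t : ℝ => ballProj r (t • z)) z (Icc 0 1) 1 := by
    refine hline.hasDerivWithinAt.congr_of_mem (fun t ht => ballProj_of_le ?_)
      ⟨zero_le_one, le_rfl⟩
    rw [norm_smul, Real.norm_of_nonneg ht.1, hz]
    exact mul_le_of_le_one_left hr.le ht.2
  have hout : HasDerivWithinAt (fun t : ℝ => ballProj r (t • z)) 0 (Ici 1) 1 := by
    refine (hasDerivWithinAt_const (1 : ℝ) (Ici 1) z).congr_of_mem (fun t ht => ?_)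
      (mem_Ici.2 le_rfl)
    have ht' : (1 : ℝ) ≤ t := ht
    have hn : ‖t • z‖ = t * r := by rw [norm_smul, Real.norm_of_nonneg (by linarith), hz]
    rw [ballProj_of_ge hr.le (by rw [hn]; nlinarith), hn, smul_smul]
    have : r / (t * r) * t = 1 := by field_simp
    rw [this, one_smul]
  have e1 := (uniqueDiffOn_Icc zero_lt_one 1 ⟨zero_le_one, le_rfl⟩).eq_deriv _
    hcomp.hasDerivWithinAt hin
  have e2 := (uniqueDiffWithinAt_Ici (1 : ℝ)).eq_deriv _ hcomp.hasDerivWithinAt hout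
  have : z = 0 := e1.symm.trans e2
  rw [this, norm_zero] at hz
  exact hr.ne hz

theorem mem_ballJacobian_of_hasFDerivAt {r : ℝ} (hr : 0 ≤ r) {z : E} {V : E →L[ℝ] E}
    (h : HasFDerivAt (ballProj r) V z) : V ∈ ballJacobian r z := by
  rcases hr.lt_or_eq with hr' | rfl
  · rcases lt_trichotomy ‖z‖ r with hz | hz | hz
    · left
      refine ⟨h.unique ((hasFDerivAt_id z).congr_of_eventuallyEq ?_), hr', hz.le⟩
      filter_upwards [continuous_norm.continuousAt.eventually_lt continuousAt_const hz] with y hy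
      exact ballProj_of_le hy.le
    · exact absurd h (not_hasFDerivAt_ballProj_of_norm_eq hr' hz)
    · right
      have hz0 : z ≠ 0 := norm_pos_iff.1 (hr'.trans hz)
      refine ⟨h.unique ((hasFDerivAt_radial hr hz0).congr_of_eventuallyEq ?_), hz.le⟩
      filter_upwards [continuousAt_const.eventually_lt continuous_norm.continuousAt hz] with y hy
      exact ballProj_of_ge hr hy.le
  · right
    refine ⟨?_, norm_nonneg z⟩
    rw [radialDeriv_zero_radius]
    have e : (ballProj 0 : E → E) = fun _ => 0 := funext ballProj_zero_radius
    rw [e] at h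
    exact h.unique (hasFDerivAt_const 0 z)

/-- Away from the origin, `V = radialDeriv r v` is the polynomial equation
`‖v‖³ V h = r (‖v‖² h - ⟪v, h⟫ v)`, which is closed in `(v, V)`. -/
theorem isClosed_graph_ballJacobian {r : ℝ} (hr : 0 ≤ r) :
    IsClosed {p : E × (E →L[ℝ] E) | p.2 ∈ ballJacobian r p.1} := by
  rcases hr.lt_or_eq with hr' | rfl
  · have : {p : E × (E →L[ℝ] E) | p.2 ∈ ballJacobian r p.1} =
        ({p | p.2 = ContinuousLinearMap.id ℝ E} ∩ {p | ‖p.1‖ ≤ r}) ∪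
        ((⋂ h : E, {p | ‖p.1‖ ^ 3 • p.2 h = r • (‖p.1‖ ^ 2 • h - inner ℝ p.1 h • p.1)}) ∩
          {p | r ≤ ‖p.1‖}) := by
      ext ⟨v, V⟩
      simp only [ballJacobian, mem_ofPred_eq, mem_union, mem_inter_iff, mem_iInter]
      refine or_congr (by simp [hr']) (and_congr_left fun hv => ?_)
      have hv' : 0 < ‖v‖ := hr'.trans_le hv
      rw [ContinuousLinearMap.ext_iff]
      refine forall_congr' fun h => ?_
      have e : r • (‖v‖ ^ 2 • h - inner ℝ v h • v) = ‖v‖ ^ 3 • radialDeriv r v h := by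
        rw [radialDeriv_apply]
        match_scalars <;> field_simp
      rw [e]
      exact (smul_right_injective E (pow_pos hv' 3).ne').eq_iff.symm
    rw [this]
    refine ((isClosed_eq (by fun_prop) (by fun_prop)).inter
      (isClosed_le (by fun_prop) (by fun_prop))).union
      ((isClosed_iInter fun h => isClosed_eq (by fun_prop) (by fun_prop)).inter
      (isClosed_le (by fun_prop) (by fun_prop)))
  · have : {p : E × (E →L[ℝ] E) | p.2 ∈ ballJacobian 0 p.1} = {p | p.2 = 0} := by
      ext ⟨v, V⟩
      simp [ballJacobian, radialDeriv_zero_radius]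
    rw [this]
    exact isClosed_eq (by fun_prop) (by fun_prop)

theorem bSubdifferential_ballProj_subset {r : ℝ} (hr : 0 ≤ r) (v : E) :
    bSubdifferential (ballProj r) v ⊆ ballJacobian r v := fun _ hV =>
  bSubdifferential_mem_of_isClosed (isClosed_graph_ballJacobian hr)
    (fun _ hz => mem_ballJacobian_of_hasFDerivAt hr hz.hasFDerivAt) hV

theorem finite_ballJacobian (r : ℝ) (v : E) : (ballJacobian r v).Finite :=
  (toFinite {ContinuousLinearMap.id ℝ E, radialDeriv r v}).subset fun V hV => by
    rcases hV with h | h <;> simp [h.1]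

theorem isCompact_clarkeJacobian_ballProj {r : ℝ} (hr : 0 ≤ r) (v : E) :
    IsCompact (clarkeJacobian (ballProj r : E → E) v) :=
  ((finite_ballJacobian r v).subset (bSubdifferential_ballProj_subset hr v)).isCompact_convexHull ℝ

/-- The ball projection is strongly semismooth: away from the sphere it is smooth, and at a point
of the sphere it agrees with the identity on one side and with the radial map on the other. -/
theorem quadraticModelAt_ballProj {r : ℝ} (hr : 0 ≤ r) (x : E) :
    QuadraticModelAt (ballProj r) (ballJacobian r) x := by
  rcases hr.lt_or_eq with hr' | rfl
  · rcases lt_or_ge ‖x‖ r with hx | hx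
    · refine ⟨0, ?_⟩
      filter_upwards [continuous_norm.continuousAt.eventually_lt continuousAt_const hx] with w hw
      rintro V (⟨rfl, -⟩ | ⟨-, hw'⟩)
      · simp [ballProj_of_le hw.le, ballProj_of_le hx.le]
      · exact absurd hw (not_lt.2 hw')
    · have hid : ∀ᶠ w : E in 𝓝 x, ‖w‖ ≤ r → ‖x‖ = r := by
        rcases hx.lt_or_eq with hx | hx
        · filter_upwards [continuousAt_const.eventually_lt continuous_norm.continuousAt hx]
            with w hw
          exact fun h => absurd hw (not_lt.2 h)
        · exact Eventually.of_forall fun _ _ => hx.symm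
      refine ⟨4 / r, ?_⟩
      filter_upwards [hid] with w hw
      rintro V (⟨rfl, -, hwr⟩ | ⟨rfl, hwr⟩)
      · simp only [ballProj_of_le hwr, ballProj_of_le (hw hwr).le, ContinuousLinearMap.id_apply,
          sub_self, norm_zero]
        positivity
      · rw [ballProj_of_ge hr hwr, ballProj_of_ge hr hx]
        refine (norm_radial_error_le hr (norm_pos_iff.1 (hr'.trans_le hwr))
          (norm_pos_iff.1 (hr'.trans_le hx))).trans ?_
        refine mul_le_mul_of_nonneg_right ?_ (by positivity)
        rw [div_le_div_iff₀ (pow_pos (hr'.trans_le hwr) 2) hr', mul_assoc, ← sq]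
        gcongr
  · refine ⟨0, Eventually.of_forall fun w => ?_⟩
    rintro V (⟨-, h, -⟩ | ⟨rfl, -⟩)
    · exact absurd h (lt_irrefl _)
    · simp [ballProj_zero_radius, radialDeriv_zero_radius]

theorem dirDifferentiable_ballProj {r : ℝ} (hr : 0 ≤ r) :
    DirDifferentiable (ballProj r : E → E) := by
  intro x d
  have hline : HasDerivAt (fun t : ℝ => x + t • d) d 0 := by
    simpa using ((hasDerivAt_id (0 : ℝ)).smul_const d).const_add x
  have hcont : Tendsto (fun t : ℝ => ‖x + t • d‖) (𝓝[>] 0) (𝓝 ‖x‖) := by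
    have : Continuous fun t : ℝ => ‖x + t • d‖ := by fun_prop
    simpa using (this.tendsto 0).mono_left nhdsWithin_le_nhds
  -- the two ways in which the projection restricts to a smooth map along the ray
  have hid : ‖x‖ ≤ r → (∀ᶠ t : ℝ in 𝓝[>] 0, ‖x + t • d‖ ≤ r) →
      ∃ f' : E, Tendsto (fun t : ℝ => t⁻¹ • (ballProj r (x + t • d) - ballProj r x))
        (𝓝[>] 0) (𝓝 f') := by
    intro hx hray
    refine ⟨d, (hline.tendsto_slope_zero_right).congr' ?_⟩
    filter_upwards [hray] with t ht
    rw [ballProj_of_le ht, ballProj_of_le hx]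
    simp
  have hrad : 0 < r → r ≤ ‖x‖ → (∀ᶠ t : ℝ in 𝓝[>] 0, r ≤ ‖x + t • d‖) →
      ∃ f' : E, Tendsto (fun t : ℝ => t⁻¹ • (ballProj r (x + t • d) - ballProj r x))
        (𝓝[>] 0) (𝓝 f') := by
    intro hr' hx hray
    have h1 : HasFDerivAt (fun z : E => (r / ‖z‖) • z) (radialDeriv r x) (x + (0 : ℝ) • d) := by
      simpa using hasFDerivAt_radial hr (norm_pos_iff.1 (hr'.trans_le hx))
    refine ⟨radialDeriv r x d,
      (h1.comp_hasDerivAt (0 : ℝ) hline).tendsto_slope_zero_right.congr' ?_⟩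
    filter_upwards [hray] with t ht
    rw [ballProj_of_ge hr ht, ballProj_of_ge hr hx]
    simp [Function.comp]
  rcases hr.lt_or_eq with hr' | rfl
  · rcases lt_trichotomy ‖x‖ r with hx | hx | hx
    · exact hid hx.le ((hcont.eventually_lt_const hx).mono fun t ht => ht.le)
    · have hsq : ∀ t : ℝ, ‖x + t • d‖ ^ 2 = r ^ 2 + t * (2 * inner ℝ x d + t * ‖d‖ ^ 2) := by
        intro t
        rw [norm_add_sq_real, norm_smul, inner_smul_right, hx, mul_pow, Real.norm_eq_abs, sq_abs]
        ring
      rcases lt_or_ge (inner ℝ x d) 0 with hd | hd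
      · refine hid hx.le ?_
        have hlim : Tendsto (fun t : ℝ => 2 * inner ℝ x d + t * ‖d‖ ^ 2) (𝓝[>] 0)
            (𝓝 (2 * inner ℝ x d)) := by
          have : Continuous fun t : ℝ => 2 * inner ℝ x d + t * ‖d‖ ^ 2 := by fun_prop
          simpa using (this.tendsto 0).mono_left nhdsWithin_le_nhds
        filter_upwards [self_mem_nhdsWithin, hlim.eventually_lt_const (by linarith : _ < (0 : ℝ))]
          with t (ht : 0 < t) ht2
        refine le_of_sq_le_sq ?_ hr
        rw [hsq]
        nlinarith
      · refine hrad hr' hx.ge ?_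
        filter_upwards [self_mem_nhdsWithin] with t (ht : 0 < t)
        refine le_of_sq_le_sq ?_ (norm_nonneg _)
        rw [hsq]
        have : 0 ≤ t * (2 * inner ℝ x d + t * ‖d‖ ^ 2) := by positivity
        linarith
    · exact hrad hr' hx.le ((hcont.eventually_const_lt hx).mono fun t ht => ht.le)
  · exact ⟨0, by simp [ballProj_zero_radius]⟩

/-! ### Positivity and commutation of the limiting derivatives -/

theorem convex_setOf_isPositive_id_sub :
    Convex ℝ {V : E →L[ℝ] E | (ContinuousLinearMap.id ℝ E - V).IsPositive} := by
  intro V hV W hW a b ha hb hab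
  have e : ContinuousLinearMap.id ℝ E - (a • V + b • W) =
      a • (ContinuousLinearMap.id ℝ E - V) + b • (ContinuousLinearMap.id ℝ E - W) := by
    have : ContinuousLinearMap.id ℝ E = (a + b) • ContinuousLinearMap.id ℝ E := by
      rw [hab, one_smul]
    rw [this, hab]
    match_scalars <;> linarith
  rw [mem_ofPred_eq, e]
  exact (ContinuousLinearMap.IsPositive.smul_of_nonneg hV ha).add
    (ContinuousLinearMap.IsPositive.smul_of_nonneg hW hb)

theorem isPositive_id_sub_of_mem_ballJacobian {r : ℝ} (hr : 0 ≤ r) {v : E} {V : E →L[ℝ] E}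
    (hV : V ∈ ballJacobian r v) : (ContinuousLinearMap.id ℝ E - V).IsPositive := by
  rcases hV with ⟨rfl, -⟩ | ⟨rfl, hv⟩
  · rw [sub_self]
    exact ContinuousLinearMap.isPositive_zero
  · have e : ContinuousLinearMap.id ℝ E - radialDeriv r v =
        (1 - r / ‖v‖) • ContinuousLinearMap.id ℝ E +
          (r / ‖v‖ * (‖v‖ ^ 2)⁻¹) • InnerProductSpace.rankOne ℝ v v := by
      rw [radialDeriv]
      module
    have h1 : 0 ≤ 1 - r / ‖v‖ := by linarith [div_le_one_of_le₀ hv (norm_nonneg v)]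
    rw [e]
    exact (ContinuousLinearMap.isPositive_id.smul_of_nonneg h1).add
      ((InnerProductSpace.isPositive_rankOne_self v).smul_of_nonneg (by positivity))

theorem isPositive_id_sub_of_mem_clarkeJacobian {r : ℝ} (hr : 0 ≤ r) {v : E} {V : E →L[ℝ] E}
    (hV : V ∈ clarkeJacobian (ballProj r) v) : (ContinuousLinearMap.id ℝ E - V).IsPositive :=
  convexHull_min (fun _ hW => isPositive_id_sub_of_mem_ballJacobian hr
    (bSubdifferential_ballProj_subset hr v hW)) convex_setOf_isPositive_id_sub hV

/-- The generalized derivatives at `v` are combinations of the identity and of `v ⊗ v`, hence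
commute with every symmetric operator that fixes `v`. -/
theorem commute_of_mem_clarkeJacobian {r : ℝ} (hr : 0 ≤ r) {v : E} {V D : E →L[ℝ] E}
    (hD : D.IsSymmetric) (hDv : D v = v) (hV : V ∈ clarkeJacobian (ballProj r) v) (h : E) :
    V (D h) = D (V h) := by
  have hconv : Convex ℝ {W : E →L[ℝ] E | ∀ h, W (D h) = D (W h)} := by
    intro W hW W' hW' a b _ _ _ h
    simp [hW h, hW' h]
  refine convexHull_min (fun W hW => ?_) hconv hV h
  rcases bSubdifferential_ballProj_subset hr v hW with ⟨rfl, -⟩ | ⟨rfl, -⟩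
  · simp
  · intro h
    have : inner ℝ v (D h) = inner ℝ v h := by
      have := hD v h
      simp only [ContinuousLinearMap.coe_coe] at this
      rw [← this, hDv]
    simp [radialDeriv_apply, this, hDv]

end Ball

/-! ### Soft thresholding: the proximal mapping of the `ℓ₁` norm -/

theorem isMinOn_of_subgradient {E : Type*} [NormedAddCommGroup E] [InnerProductSpace ℝ E]
    {p : E → ℝ} {u x : E} (h : ∀ y, p x + inner ℝ (u - x) (y - x) ≤ p y) :
    IsMinOn (fun y => p y + 1 / 2 * ‖y - u‖ ^ 2) univ x := by
  intro y _
  have e : y - u = (y - x) - (u - x) := by abel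
  have h1 := h y
  change p x + 1 / 2 * ‖x - u‖ ^ 2 ≤ p y + 1 / 2 * ‖y - u‖ ^ 2
  rw [e, norm_sub_sq_real (y - x), real_inner_comm, norm_sub_rev x u]
  nlinarith [sq_nonneg ‖y - x‖]

namespace SGLasso

variable {n : ℕ}

theorem prox_l1Part_spec {lam : ℝ} (hlam : 0 ≤ lam) (u x : EuclideanSpace ℝ (Fin n)) :
    x = prox (l1Part lam) u ↔
      IsMinOn (fun y => l1Part lam y + 1 / 2 * ‖y - u‖ ^ 2) univ x := by
  -- the `ℓ₁` part is the regularizer of an empty family of groups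
  have e : regularizer (fun i : Fin 0 => i.elim0) lam 0 (fun i : Fin 0 => i.elim0) =
      l1Part (n := n) lam := by
    funext y
    simp [regularizer]
  have := regularizer_prox_spec (n := n) (fun i : Fin 0 => i.elim0) (w := fun i : Fin 0 => i.elim0)
    hlam le_rfl (fun i => i.elim0) u x
  rwa [e] at this

theorem l1Part_add_inner_le {lam : ℝ} {q x : EuclideanSpace ℝ (Fin n)}
    (hq : ∀ i, |q i| ≤ lam) (hqx : ∀ i, q i * x i = lam * |x i|)
    (y : EuclideanSpace ℝ (Fin n)) :
    l1Part lam x + inner ℝ q (y - x) ≤ l1Part lam y := by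
  simp only [l1Part, PiLp.inner_apply, Finset.mul_sum, ← Finset.sum_add_distrib]
  refine Finset.sum_le_sum fun i _ => ?_
  have h1 : q i * y i ≤ lam * |y i| := by
    refine (le_abs_self _).trans ?_
    rw [abs_mul]
    gcongr
    exact hq i
  have h2 : inner ℝ (q i) ((y - x) i) = q i * y i - q i * x i := by
    simp
    ring
  rw [h2, hqx]
  linarith

/-- Soft thresholding at level `lam`, written as the residual of the projection of each coordinate
onto `[-lam, lam]`. -/
noncomputable def softThreshold (lam : ℝ) (u : EuclideanSpace ℝ (Fin n)) :
    EuclideanSpace ℝ (Fin n) :=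
  WithLp.toLp 2 fun i => u i - ballProj lam (u i)

theorem softThreshold_apply (lam : ℝ) (u : EuclideanSpace ℝ (Fin n)) (i : Fin n) :
    softThreshold lam u i = u i - ballProj lam (u i) := rfl

theorem abs_sub_softThreshold_le {lam : ℝ} (hlam : 0 ≤ lam) (u : EuclideanSpace ℝ (Fin n))
    (i : Fin n) : |u i - softThreshold lam u i| ≤ lam := by
  rw [softThreshold_apply, sub_sub_cancel]
  exact norm_ballProj_le hlam (u i)

theorem sub_softThreshold_mul {lam : ℝ} (hlam : 0 ≤ lam) (u : EuclideanSpace ℝ (Fin n))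
    (i : Fin n) :
    (u i - softThreshold lam u i) * softThreshold lam u i = lam * |softThreshold lam u i| := by
  rw [softThreshold_apply, sub_sub_cancel, ← Real.norm_eq_abs, ← inner_ballProj_sub hlam (u i)]
  simp [mul_comm]

theorem prox_l1Part {lam : ℝ} (hlam : 0 ≤ lam) :
    prox (l1Part (n := n) lam) = softThreshold lam := by
  funext u
  symm
  rw [prox_l1Part_spec hlam]
  exact isMinOn_of_subgradient (l1Part_add_inner_le (abs_sub_softThreshold_le hlam u)
    (sub_softThreshold_mul hlam u))

theorem lt_abs_of_softThreshold_ne_zero {lam : ℝ} {u : EuclideanSpace ℝ (Fin n)} {i : Fin n}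
    (h : softThreshold lam u i ≠ 0) : lam < |u i| := by
  by_contra! hu
  exact h (by rw [softThreshold_apply, ballProj_of_le hu, sub_self])

theorem lipschitzWith_softThreshold {lam : ℝ} (hlam : 0 ≤ lam) :
    LipschitzWith 1 (softThreshold (n := n) lam) :=
  LipschitzWith.of_dist_le_mul fun u w => by
    rw [dist_eq_norm, dist_eq_norm, NNReal.coe_one, one_mul]
    refine le_of_sq_le_sq ?_ (norm_nonneg _)
    rw [EuclideanSpace.norm_sq_eq, EuclideanSpace.norm_sq_eq]
    refine Finset.sum_le_sum fun i _ => ?_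
    gcongr
    exact norm_sub_ballProj_sub_le hlam (u i) (w i)

theorem dirDifferentiable_softThreshold {lam : ℝ} (hlam : 0 ≤ lam) :
    DirDifferentiable (softThreshold (n := n) lam) :=
  dirDifferentiable_block (β := fun _ : Fin n => ℝ) (f := fun _ t => t - ballProj lam t)
    (L := fun i => (EuclideanSpace.proj i : EuclideanSpace ℝ (Fin n) →L[ℝ] ℝ))
    fun _ => (dirDifferentiable_ballProj hlam).id_sub

/-- The diagonal operator with diagonal `θ`. -/
noncomputable def diagOp {ι : Type*} [Fintype ι] (θ : ι → ℝ) :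
    EuclideanSpace ℝ (ι) →L[ℝ] EuclideanSpace ℝ (ι) :=
  LinearMap.toContinuousLinearMap
    { toFun := fun x => WithLp.toLp 2 fun i => θ i * x i
      map_add' := fun _ _ => by ext; simp [mul_add]
      map_smul' := fun _ _ => by ext; simp [mul_left_comm] }

theorem diagOp_apply {ι : Type*} [Fintype ι] (θ : ι → ℝ) (x : EuclideanSpace ℝ (ι)) (i : ι) :
    diagOp θ x i = θ i * x i := rfl

theorem inner_diagOp {ι : Type*} [Fintype ι] (θ : ι → ℝ) (x y : EuclideanSpace ℝ (ι)) :
    inner ℝ (diagOp θ x) y = inner ℝ x (diagOp θ y) := by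
  simp only [PiLp.inner_apply, diagOp_apply]
  refine Finset.sum_congr rfl fun i _ => ?_
  simp only [Real.inner_apply]
  ring

theorem adjoint_diagOp {ι : Type*} [Fintype ι] (θ : ι → ℝ) :
    ContinuousLinearMap.adjoint (diagOp θ) = diagOp θ :=
  ((ContinuousLinearMap.eq_adjoint_iff _ _).2 (inner_diagOp θ)).symm

theorem eq_diagOp {A : EuclideanSpace ℝ (Fin n) →L[ℝ] EuclideanSpace ℝ (Fin n)}
    (hA : ∀ h i, A h i = A (EuclideanSpace.single i 1) i * h i) :
    A = diagOp fun i => A (EuclideanSpace.single i 1) i := by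
  ext h i
  exact hA h i

/-- In dimension one the radial map is locally constant. -/
theorem radialDeriv_real (r t : ℝ) : radialDeriv r t = 0 := by
  ext
  rw [radialDeriv_apply]
  rcases eq_or_ne t 0 with rfl | ht
  · simp
  · simp
    right
    field_simp
    simp

theorem eq_zero_or_one_of_mem_ballJacobian {r t θ : ℝ}
    (h : (1 - θ) • ContinuousLinearMap.id ℝ ℝ ∈ ballJacobian r t) :
    (θ = 0 ∨ θ = 1) ∧ (r < |t| → θ = 1) := by
  rcases h with ⟨h, -, ht⟩ | ⟨h, -⟩
  · have : 1 - θ = 1 := by simpa using congrArg (fun A : ℝ →L[ℝ] ℝ => A 1) h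
    exact ⟨Or.inl (by linarith), fun h' => absurd h' (not_lt.2 ht)⟩
  · have : 1 - θ = 0 := by
      simpa [radialDeriv_real] using congrArg (fun A : ℝ →L[ℝ] ℝ => A 1) h
    exact ⟨Or.inr (by linarith), fun _ => by linarith⟩

theorem fderiv_softThreshold {lam : ℝ} (hlam : 0 ≤ lam) {z : EuclideanSpace ℝ (Fin n)}
    {A : EuclideanSpace ℝ (Fin n) →L[ℝ] EuclideanSpace ℝ (Fin n)}
    (hA : HasFDerivAt (softThreshold lam) A z) (i : Fin n) :
    (∀ h, A h i = A (EuclideanSpace.single i 1) i * h i) ∧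
      (1 - A (EuclideanSpace.single i 1) i) • ContinuousLinearMap.id ℝ ℝ ∈
        ballJacobian lam (z i) := by
  set c := A (EuclideanSpace.single i 1) i with hc
  have hAi : HasFDerivAt (fun x => softThreshold lam x i)
      ((EuclideanSpace.proj i : EuclideanSpace ℝ (Fin n) →L[ℝ] ℝ).comp A) z :=
    (EuclideanSpace.proj i : EuclideanSpace ℝ (Fin n) →L[ℝ] ℝ).hasFDerivAt.comp z hA
  -- restricting to the `i`-th coordinate line through `z` differentiates the scalar threshold
  have hS : HasDerivAt (fun t : ℝ => t - ballProj lam t) c (z i) := by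
    have hline : HasDerivAt (fun t : ℝ => z + (t - z i) • EuclideanSpace.single i (1 : ℝ))
        (EuclideanSpace.single i (1 : ℝ)) (z i) := by
      simpa using (((hasDerivAt_id (z i)).sub_const (z i)).smul_const
        (EuclideanSpace.single i (1 : ℝ))).const_add z
    have hAi' : HasFDerivAt (fun x => softThreshold lam x i)
        ((EuclideanSpace.proj i : EuclideanSpace ℝ (Fin n) →L[ℝ] ℝ).comp A)
        (z + (z i - z i) • EuclideanSpace.single i (1 : ℝ)) := by simpa using hAi
    have h := (hAi'.comp_hasDerivAt (z i) hline :)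
    have e : (fun x : EuclideanSpace ℝ (Fin n) => softThreshold lam x i) ∘
        (fun t : ℝ => z + (t - z i) • EuclideanSpace.single i (1 : ℝ)) =
        fun t : ℝ => t - ballProj lam t := by
      funext t
      simp [softThreshold_apply]
    rw [e] at h
    exact h
  constructor
  · intro h
    have h1 : HasFDerivAt (fun x => softThreshold lam x i)
        (c • (EuclideanSpace.proj i : EuclideanSpace ℝ (Fin n) →L[ℝ] ℝ)) z :=
      (hS.comp_hasFDerivAt z
        (EuclideanSpace.proj i : EuclideanSpace ℝ (Fin n) →L[ℝ] ℝ).hasFDerivAt :)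
    have := congrArg (fun B : EuclideanSpace ℝ (Fin n) →L[ℝ] ℝ => B h) (hAi.unique h1)
    simpa using this
  · apply mem_ballJacobian_of_hasFDerivAt hlam
    have h1 : HasDerivAt (fun t : ℝ => t - (t - ballProj lam t)) (1 - c) (z i) :=
      (hasDerivAt_id (z i)).sub hS
    simp only [sub_sub_cancel] at h1
    have e : (1 - c) • ContinuousLinearMap.id ℝ ℝ =
        ContinuousLinearMap.toSpanSingleton ℝ (1 - c) := by
      ext
      simp
    rw [e]
    exact h1.hasFDerivAt

theorem bSubdifferential_softThreshold {lam : ℝ} (hlam : 0 ≤ lam)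
    {u : EuclideanSpace ℝ (Fin n)}
    {A : EuclideanSpace ℝ (Fin n) →L[ℝ] EuclideanSpace ℝ (Fin n)}
    (hA : A ∈ bSubdifferential (softThreshold lam) u) (i : Fin n) :
    (∀ h, A h i = A (EuclideanSpace.single i 1) i * h i) ∧
      (1 - A (EuclideanSpace.single i 1) i) • ContinuousLinearMap.id ℝ ℝ ∈
        ballJacobian lam (u i) := by
  have hT : IsClosed {p : EuclideanSpace ℝ (Fin n) ×
      (EuclideanSpace ℝ (Fin n) →L[ℝ] EuclideanSpace ℝ (Fin n)) |
      (∀ h, p.2 h i = p.2 (EuclideanSpace.single i 1) i * h i) ∧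
      (1 - p.2 (EuclideanSpace.single i 1) i) • ContinuousLinearMap.id ℝ ℝ ∈
        ballJacobian lam (p.1 i)} := by
    refine IsClosed.inter (s₁ := {p | ∀ h, _ = _}) ?_ ?_
    · simp only [ofPred_forall]
      exact isClosed_iInter fun h => isClosed_eq (by fun_prop) (by fun_prop)
    · have hc : Continuous fun p : EuclideanSpace ℝ (Fin n) ×
          (EuclideanSpace ℝ (Fin n) →L[ℝ] EuclideanSpace ℝ (Fin n)) =>
          (p.1 i, (1 - p.2 (EuclideanSpace.single i 1) i) • ContinuousLinearMap.id ℝ ℝ) := by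
        fun_prop
      exact (isClosed_graph_ballJacobian hlam).preimage hc
  exact bSubdifferential_mem_of_isClosed hT
    (fun z hz => fderiv_softThreshold hlam hz.hasFDerivAt i) hA

theorem isCompact_clarkeJacobian_softThreshold {lam : ℝ} (hlam : 0 ≤ lam)
    (u : EuclideanSpace ℝ (Fin n)) : IsCompact (clarkeJacobian (softThreshold lam) u) := by
  have hfin : (diagOp '' (univ.pi fun _ : Fin n => ({0, 1} : Set ℝ))).Finite :=
    (Set.Finite.pi' fun _ => toFinite ({0, 1} : Set ℝ)).subset (by intro x; simp) |>.image _
  refine (hfin.subset fun A hA => ?_).isCompact_convexHull ℝ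
  have h := bSubdifferential_softThreshold hlam hA
  refine ⟨_, fun i _ => ?_, (eq_diagOp fun x i => (h i).1 x).symm⟩
  exact (eq_zero_or_one_of_mem_ballJacobian (h i).2).1

/-- Every generalized derivative of soft thresholding is diagonal with nonnegative entries, equal
to `1` on the coordinates that survive. -/
theorem exists_diagOp_of_mem_clarkeJacobian {lam : ℝ} (hlam : 0 ≤ lam)
    {u : EuclideanSpace ℝ (Fin n)}
    {A : EuclideanSpace ℝ (Fin n) →L[ℝ] EuclideanSpace ℝ (Fin n)}
    (hA : A ∈ clarkeJacobian (softThreshold lam) u) :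
    ∃ θ : Fin n → ℝ, A = diagOp θ ∧ ∀ i, 0 ≤ θ i ∧ (softThreshold lam u i ≠ 0 → θ i = 1) := by
  have hconv : Convex ℝ {B : EuclideanSpace ℝ (Fin n) →L[ℝ] EuclideanSpace ℝ (Fin n) |
      ∀ i, (∀ h, B h i = B (EuclideanSpace.single i 1) i * h i) ∧
        0 ≤ B (EuclideanSpace.single i 1) i ∧
        (lam < |u i| → B (EuclideanSpace.single i 1) i = 1)} := by
    intro B hB B' hB' a b ha hb hab i
    obtain ⟨h1, h2, h3⟩ := hB i
    obtain ⟨h1', h2', h3'⟩ := hB' i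
    refine ⟨fun h => ?_, ?_, fun hu => ?_⟩
    · simp only [add_apply, smul_apply, PiLp.add_apply,
        PiLp.smul_apply, smul_eq_mul, h1 h, h1' h]
      ring
    · simp only [add_apply, smul_apply, PiLp.add_apply,
        PiLp.smul_apply, smul_eq_mul]
      positivity
    · simp only [add_apply, smul_apply, PiLp.add_apply,
        PiLp.smul_apply, smul_eq_mul, h3 hu, h3' hu]
      linarith
  have h := convexHull_min (fun B hB i => ?_) hconv hA
  · exact ⟨_, eq_diagOp fun x i => (h i).1 x, fun i =>
      ⟨(h i).2.1, fun hi => (h i).2.2 (lt_abs_of_softThreshold_ne_zero hi)⟩⟩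
  · obtain ⟨h1, h2⟩ := bSubdifferential_softThreshold hlam hB i
    obtain ⟨h3, h4⟩ := eq_zero_or_one_of_mem_ballJacobian h2
    exact ⟨h1, by rcases h3 with h3 | h3 <;> rw [h3]; exact zero_le_one, h4⟩

theorem quadraticModelAt_softThreshold {lam : ℝ} (hlam : 0 ≤ lam)
    (u : EuclideanSpace ℝ (Fin n)) :
    QuadraticModelAt (softThreshold lam) (clarkeJacobian (softThreshold lam)) u := by
  apply QuadraticModelAt.clarkeJacobian
  obtain ⟨C, hC⟩ := norm_block_error_le (L := fun i : Fin n => EuclideanSpace.proj i)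
    (x := u) fun i => quadraticModelAt_ballProj hlam (u i)
  refine ⟨C, hC.mono fun w hw A hA => ?_⟩
  have h := bSubdifferential_softThreshold hlam hA
  refine le_of_eq_of_le ?_ (hw _ fun i => (h i).2)
  rw [← norm_neg]
  congr 1
  ext i
  simp only [PiLp.neg_apply, PiLp.sub_apply, softThreshold_apply, (h i).1 (w - u)]
  simp
  ring

end SGLasso

namespace SGLasso

/-! ### Splitting a vector into groups -/

section Groups

variable {n g : ℕ} {G : Fin g → Finset (Fin n)}

theorem groupMap_apply (x : EuclideanSpace ℝ (Fin n)) (l : Fin g) :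
    groupMap G x l = restr (G l) x := rfl

theorem restr_apply (s : Finset (Fin n)) (x : EuclideanSpace ℝ (Fin n)) (i : s) :
    restr s x i = x i := rfl

theorem sum_sum_groups (hdisj : ∀ i j, i ≠ j → Disjoint (G i) (G j))
    (hcover : ∀ k : Fin n, ∃ l, k ∈ G l) (f : Fin n → ℝ) :
    ∑ l, ∑ i : G l, f i = ∑ i, f i := by
  have h : Finset.univ.biUnion G = Finset.univ := by
    ext k
    simpa using hcover k
  rw [← h, Finset.sum_biUnion fun i _ j _ hij => hdisj i j hij]
  exact Finset.sum_congr rfl fun l _ => Finset.sum_coe_sort (G l) f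

theorem sum_inner_restr (hdisj : ∀ i j, i ≠ j → Disjoint (G i) (G j))
    (hcover : ∀ k : Fin n, ∃ l, k ∈ G l) (x y : EuclideanSpace ℝ (Fin n)) :
    ∑ l, inner ℝ (restr (G l) x) (restr (G l) y) = inner ℝ x y := by
  simp only [PiLp.inner_apply, restr_apply]
  exact sum_sum_groups hdisj hcover fun i => inner ℝ (x i) (y i)

theorem sum_norm_restr_sq (hdisj : ∀ i j, i ≠ j → Disjoint (G i) (G j))
    (hcover : ∀ k : Fin n, ∃ l, k ∈ G l) (x : EuclideanSpace ℝ (Fin n)) :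
    ∑ l, ‖restr (G l) x‖ ^ 2 = ‖x‖ ^ 2 := by
  simp only [← real_inner_self_eq_norm_sq]
  exact sum_inner_restr hdisj hcover x x

theorem ext_restr (hcover : ∀ k : Fin n, ∃ l, k ∈ G l) {x y : EuclideanSpace ℝ (Fin n)}
    (h : ∀ l, restr (G l) x = restr (G l) y) : x = y := by
  ext k
  obtain ⟨l, hl⟩ := hcover k
  exact congrArg (fun z : EuclideanSpace ℝ (G l) => z ⟨k, hl⟩) (h l)

theorem groupMap_surjective (hdisj : ∀ i j, i ≠ j → Disjoint (G i) (G j))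
    (hcover : ∀ k : Fin n, ∃ l, k ∈ G l) : Function.Surjective (groupMap G) := by
  intro y
  choose c hc using hcover
  refine ⟨WithLp.toLp 2 fun k => y (c k) ⟨k, hc k⟩, ?_⟩
  ext l ⟨k, hk⟩
  have hl : c k = l := by
    by_contra hne
    exact Finset.disjoint_left.1 (hdisj _ _ hne) (hc k) hk
  subst hl
  rfl

/-- For a partition into groups `P` is a surjective isometry, so `P P* = I`. -/
theorem restr_adjoint_groupMap (hdisj : ∀ i j, i ≠ j → Disjoint (G i) (G j))
    (hcover : ∀ k : Fin n, ∃ l, k ∈ G l) (y : GroupSpace G) (l : Fin g) :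
    restr (G l) (ContinuousLinearMap.adjoint (groupMap G) y) = y l := by
  obtain ⟨x, rfl⟩ := groupMap_surjective hdisj hcover y
  have h : ContinuousLinearMap.adjoint (groupMap G) (groupMap G x) = x := by
    refine ext_inner_right ℝ fun z => ?_
    rw [ContinuousLinearMap.adjoint_inner_left, PiLp.inner_apply]
    exact sum_inner_restr hdisj hcover x z
  rw [h, groupMap_apply]

/-! ### The proximal mapping of the sparse group Lasso regularizer -/

/-- The proximal mapping of `x ↦ ∑ₗ rₗ ‖x_{Gₗ}‖`, by Moreau's identity the residual of the
projections of the groups onto the balls of radii `rₗ`. -/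
noncomputable def groupProx (G : Fin g → Finset (Fin n)) (r : Fin g → ℝ)
    (v : EuclideanSpace ℝ (Fin n)) : EuclideanSpace ℝ (Fin n) :=
  v - ContinuousLinearMap.adjoint (groupMap G)
    (WithLp.toLp 2 fun l => ballProj (r l) (restr (G l) v))

theorem restr_groupProx (hdisj : ∀ i j, i ≠ j → Disjoint (G i) (G j))
    (hcover : ∀ k : Fin n, ∃ l, k ∈ G l) (r : Fin g → ℝ) (v : EuclideanSpace ℝ (Fin n))
    (l : Fin g) :
    restr (G l) (groupProx G r v) = restr (G l) v - ballProj (r l) (restr (G l) v) := by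
  rw [groupProx, map_sub, restr_adjoint_groupMap hdisj hcover]

theorem lipschitzWith_groupProx (hdisj : ∀ i j, i ≠ j → Disjoint (G i) (G j))
    (hcover : ∀ k : Fin n, ∃ l, k ∈ G l) {r : Fin g → ℝ} (hr : ∀ l, 0 ≤ r l) :
    LipschitzWith 1 (groupProx G r) :=
  LipschitzWith.of_dist_le_mul fun v v' => by
    rw [dist_eq_norm, dist_eq_norm, NNReal.coe_one, one_mul]
    refine le_of_sq_le_sq ?_ (norm_nonneg _)
    rw [← sum_norm_restr_sq hdisj hcover, ← sum_norm_restr_sq hdisj hcover (v - v')]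
    refine Finset.sum_le_sum fun l _ => ?_
    rw [map_sub, restr_groupProx hdisj hcover, restr_groupProx hdisj hcover, map_sub]
    gcongr
    exact norm_sub_ballProj_sub_le (hr l) _ _

theorem dirDifferentiable_groupProx {r : Fin g → ℝ} (hr : ∀ l, 0 ≤ r l) :
    DirDifferentiable (groupProx G r) := by
  have h : DirDifferentiable fun v =>
      (WithLp.toLp 2 fun l => ballProj (r l) (restr (G l) v) : GroupSpace G) :=
    dirDifferentiable_block (L := fun l => restr (G l)) fun l => dirDifferentiable_ballProj (hr l)
  refine DirDifferentiable.id_sub fun x d => ?_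
  obtain ⟨f', hf'⟩ := h x d
  refine ⟨ContinuousLinearMap.adjoint (groupMap G) f',
    (((ContinuousLinearMap.adjoint (groupMap G)).continuous.tendsto f').comp hf').congr
      fun t => ?_⟩
  simp only [Function.comp, map_smul, map_sub]

/-- `Prox_p` is the composition of the group proximal mapping with soft thresholding: shrinking a
group does not change the signs of its coordinates, so `u - v`, a subgradient of the `ℓ₁` part at
the thresholded vector `v`, remains one at the shrunk vector. -/
theorem prox_regularizer (hdisj : ∀ i j, i ≠ j → Disjoint (G i) (G j))
    (hcover : ∀ k : Fin n, ∃ l, k ∈ G l) {lam1 lam2 : ℝ} (hlam1 : 0 ≤ lam1) (hlam2 : 0 ≤ lam2)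
    {w : Fin g → ℝ} (hw : ∀ l, 0 < w l) :
    prox (regularizer G lam1 lam2 w) =
      groupProx G (fun l => lam2 * w l) ∘ softThreshold lam1 := by
  funext u
  symm
  rw [regularizer_prox_spec G hlam1 hlam2 hw]
  have hr : ∀ l, 0 ≤ lam2 * w l := fun l => mul_nonneg hlam2 (hw l).le
  simp only [Function.comp]
  set v := softThreshold lam1 u with hv
  set x := groupProx G (fun l => lam2 * w l) v with hx
  have hxl : ∀ l, restr (G l) x = restr (G l) v - ballProj (lam2 * w l) (restr (G l) v) :=
    restr_groupProx hdisj hcover _ v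
  refine isMinOn_of_subgradient fun y => ?_
  have h1 : l1Part lam1 x + inner ℝ (u - v) (y - x) ≤ l1Part lam1 y := by
    refine l1Part_add_inner_le (abs_sub_softThreshold_le hlam1 u) (fun i => ?_) y
    obtain ⟨l, hl⟩ := hcover i
    obtain ⟨c, hc, hcv⟩ := exists_sub_ballProj_eq_smul (hr l) (restr (G l) v)
    have hxi : x i = c * v i :=
      congrArg (fun z : EuclideanSpace ℝ (G l) => z ⟨i, hl⟩) ((hxl l).trans hcv)
    have hm : (u - v) i * v i = lam1 * |v i| := sub_softThreshold_mul hlam1 u i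
    rw [hxi, abs_mul, abs_of_nonneg hc, mul_left_comm, hm]
    ring
  have h2 : lam2 * ∑ l, w l * ‖restr (G l) x‖ + inner ℝ (v - x) (y - x) ≤
      lam2 * ∑ l, w l * ‖restr (G l) y‖ := by
    rw [← sum_inner_restr hdisj hcover, Finset.mul_sum, Finset.mul_sum,
      ← Finset.sum_add_distrib]
    refine Finset.sum_le_sum fun l _ => ?_
    have e : restr (G l) (v - x) = ballProj (lam2 * w l) (restr (G l) v) := by
      rw [map_sub, hxl, sub_sub_cancel]
    have e2 : inner ℝ (ballProj (lam2 * w l) (restr (G l) v)) (restr (G l) x) =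
        lam2 * w l * ‖restr (G l) x‖ := by
      rw [hxl]
      exact inner_ballProj_sub (hr l) _
    have e3 : inner ℝ (ballProj (lam2 * w l) (restr (G l) v)) (restr (G l) y) ≤
        lam2 * w l * ‖restr (G l) y‖ :=
      (real_inner_le_norm _ _).trans
        (mul_le_mul_of_nonneg_right (norm_ballProj_le (hr l) _) (norm_nonneg _))
    rw [e, map_sub, inner_sub_right, e2]
    linarith
  have h3 : inner ℝ (u - x) (y - x) = inner ℝ (u - v) (y - x) + inner ℝ (v - x) (y - x) := by
    rw [← inner_add_left, sub_add_sub_cancel]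
  simp only [regularizer]
  linarith

/-! ### The operators `I - P* Σ P` -/

/-- The operator `I - P* Diag(Σ₁, …, Σ_g) P`. -/
noncomputable def residualOp (G : Fin g → Finset (Fin n))
    (S : ∀ l, EuclideanSpace ℝ (G l) →L[ℝ] EuclideanSpace ℝ (G l)) :
    EuclideanSpace ℝ (Fin n) →L[ℝ] EuclideanSpace ℝ (Fin n) :=
  ContinuousLinearMap.id ℝ _ -
    (ContinuousLinearMap.adjoint (groupMap G)).comp ((blockDiag G S).comp (groupMap G))

theorem restr_residualOp (hdisj : ∀ i j, i ≠ j → Disjoint (G i) (G j))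
    (hcover : ∀ k : Fin n, ∃ l, k ∈ G l)
    (S : ∀ l, EuclideanSpace ℝ (G l) →L[ℝ] EuclideanSpace ℝ (G l))
    (x : EuclideanSpace ℝ (Fin n)) (l : Fin g) :
    restr (G l) (residualOp G S x) =
      (ContinuousLinearMap.id ℝ (EuclideanSpace ℝ (G l)) - S l) (restr (G l) x) := by
  have : residualOp G S x = x - ContinuousLinearMap.adjoint (groupMap G)
      (blockDiag G S (groupMap G x)) := rfl
  rw [this, map_sub, restr_adjoint_groupMap hdisj hcover]
  rfl

theorem continuous_blockDiag : Continuous (blockDiag G) := by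
  let B : (∀ l, EuclideanSpace ℝ (G l) →L[ℝ] EuclideanSpace ℝ (G l)) →ₗ[ℝ]
      (GroupSpace G →L[ℝ] GroupSpace G) :=
    { toFun := blockDiag G
      map_add' := fun _ _ => rfl
      map_smul' := fun _ _ => rfl }
  exact B.continuous_of_finiteDimensional

theorem continuous_residualOp : Continuous (residualOp G) := by
  unfold residualOp
  exact continuous_const.sub
    (continuous_const.clm_comp (continuous_blockDiag.clm_comp continuous_const))

theorem isPositive_residualOp (hdisj : ∀ i j, i ≠ j → Disjoint (G i) (G j))
    (hcover : ∀ k : Fin n, ∃ l, k ∈ G l)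
    {S : ∀ l, EuclideanSpace ℝ (G l) →L[ℝ] EuclideanSpace ℝ (G l)}
    (hS : ∀ l, (ContinuousLinearMap.id ℝ _ - S l).IsPositive) :
    (residualOp G S).IsPositive := by
  rw [ContinuousLinearMap.isPositive_iff]
  refine ⟨fun x y => ?_, fun x => ?_⟩
  · simp only [ContinuousLinearMap.coe_coe]
    rw [← sum_inner_restr hdisj hcover, ← sum_inner_restr hdisj hcover x]
    refine Finset.sum_congr rfl fun l _ => ?_
    rw [restr_residualOp hdisj hcover, restr_residualOp hdisj hcover]
    exact (hS l).inner_left_eq_inner_right _ _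
  · rw [← sum_inner_restr hdisj hcover]
    refine Finset.sum_nonneg fun l _ => ?_
    rw [restr_residualOp hdisj hcover]
    exact (hS l).inner_nonneg_left _

theorem residualOp_comp_diagOp (hdisj : ∀ i j, i ≠ j → Disjoint (G i) (G j))
    (hcover : ∀ k : Fin n, ∃ l, k ∈ G l) {r : Fin g → ℝ} (hr : ∀ l, 0 ≤ r l)
    {v : EuclideanSpace ℝ (Fin n)}
    {S : ∀ l, EuclideanSpace ℝ (G l) →L[ℝ] EuclideanSpace ℝ (G l)}
    (hS : ∀ l, S l ∈ clarkeJacobian (ballProj (r l)) (restr (G l) v))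
    {d : Fin n → ℝ} (hd : ∀ i, d i * v i = v i) :
    (residualOp G S).comp (diagOp d) = (diagOp d).comp (residualOp G S) := by
  ext1 x
  refine ext_restr hcover fun l => ?_
  have hrestr : ∀ y, restr (G l) (diagOp d y) =
      diagOp (fun i : G l => d i) (restr (G l) y) := fun _ => rfl
  have hfix : diagOp (fun i : G l => d i) (restr (G l) v) = restr (G l) v := by
    ext i
    exact hd i
  have hcomm := commute_of_mem_clarkeJacobian (hr l)
    (fun a b => inner_diagOp (fun i : G l => d i) a b) hfix (hS l) (restr (G l) x)
  simp only [ContinuousLinearMap.comp_apply]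
  rw [restr_residualOp hdisj hcover, hrestr, hrestr, restr_residualOp hdisj hcover]
  simp only [sub_apply, ContinuousLinearMap.id_apply, map_sub, hcomm]

/-- With `D = √Θ`, which fixes `v` and hence commutes with `I - P* Σ P`, the product is the
congruence `D (I - P* Σ P) D`. -/
theorem isPositive_residualOp_comp_diagOp (hdisj : ∀ i j, i ≠ j → Disjoint (G i) (G j))
    (hcover : ∀ k : Fin n, ∃ l, k ∈ G l) {r : Fin g → ℝ} (hr : ∀ l, 0 ≤ r l)
    {v : EuclideanSpace ℝ (Fin n)}
    {S : ∀ l, EuclideanSpace ℝ (G l) →L[ℝ] EuclideanSpace ℝ (G l)}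
    (hS : ∀ l, S l ∈ clarkeJacobian (ballProj (r l)) (restr (G l) v))
    {θ : Fin n → ℝ} (hθ : ∀ i, 0 ≤ θ i ∧ (v i ≠ 0 → θ i = 1)) :
    ((residualOp G S).comp (diagOp θ)).IsPositive := by
  set d : Fin n → ℝ := fun i => √(θ i)
  have hd : ∀ i, d i * v i = v i := by
    intro i
    rcases eq_or_ne (v i) 0 with h | h
    · simp [h]
    · simp [d, (hθ i).2 h]
  have hsq : diagOp θ = (diagOp d).comp (diagOp d) := by
    ext x i
    simp only [ContinuousLinearMap.comp_apply, diagOp_apply, ← mul_assoc, d,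
      Real.mul_self_sqrt (hθ i).1]
  have e : (residualOp G S).comp (diagOp θ) =
      (diagOp d).comp ((residualOp G S).comp (ContinuousLinearMap.adjoint (diagOp d))) := by
    rw [adjoint_diagOp, hsq, ← ContinuousLinearMap.comp_assoc,
      residualOp_comp_diagOp hdisj hcover hr hS hd, ContinuousLinearMap.comp_assoc,
      residualOp_comp_diagOp hdisj hcover hr hS hd]
  rw [e]
  exact (isPositive_residualOp hdisj hcover fun l =>
    isPositive_id_sub_of_mem_clarkeJacobian (hr l) (hS l)).conj_adjoint _

/-- The operators `I - P* Σ P` with `Σₗ ∈ ∂Π_{Bₗ}(v_{Gₗ})`. -/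
def groupJacobian (G : Fin g → Finset (Fin n)) (r : Fin g → ℝ) (v : EuclideanSpace ℝ (Fin n)) :
    Set (EuclideanSpace ℝ (Fin n) →L[ℝ] EuclideanSpace ℝ (Fin n)) :=
  residualOp G '' univ.pi fun l => clarkeJacobian (ballProj (r l)) (restr (G l) v)

theorem quadraticModelAt_groupProx {r : Fin g → ℝ} (hr : ∀ l, 0 ≤ r l)
    (v : EuclideanSpace ℝ (Fin n)) :
    QuadraticModelAt (groupProx G r) (groupJacobian G r) v := by
  obtain ⟨C, hC⟩ := norm_block_error_le (L := fun l => restr (G l)) (x := v) fun l =>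
    ((quadraticModelAt_ballProj (hr l) (restr (G l) v)).mono
      (bSubdifferential_ballProj_subset (hr l))).clarkeJacobian
  refine ⟨‖ContinuousLinearMap.adjoint (groupMap G)‖ * C, hC.mono fun v' hv' => ?_⟩
  rintro _ ⟨S, hS, rfl⟩
  have e : groupProx G r v' - groupProx G r v - residualOp G S (v' - v) =
      -ContinuousLinearMap.adjoint (groupMap G)
        (WithLp.toLp 2 fun l => ballProj (r l) (restr (G l) v') -
          ballProj (r l) (restr (G l) v) - S l (restr (G l) (v' - v))) := by
    have e1 : (WithLp.toLp 2 fun l => ballProj (r l) (restr (G l) v') -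
          ballProj (r l) (restr (G l) v) - S l (restr (G l) (v' - v)) : GroupSpace G) =
        WithLp.toLp 2 (fun l => ballProj (r l) (restr (G l) v')) -
          WithLp.toLp 2 (fun l => ballProj (r l) (restr (G l) v)) -
            blockDiag G S (groupMap G (v' - v)) := rfl
    have e2 : residualOp G S (v' - v) = v' - v - ContinuousLinearMap.adjoint (groupMap G)
      (blockDiag G S (groupMap G (v' - v))) := rfl
    rw [e1, e2]
    generalize blockDiag G S (groupMap G (v' - v)) = N
    simp only [groupProx, map_sub]
    abel
  rw [e, norm_neg, mul_assoc]
  exact (ContinuousLinearMap.le_opNorm _ _).trans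
    (mul_le_mul_of_nonneg_left (hv' S fun l => hS l (mem_univ l)) (norm_nonneg _))

theorem exists_norm_le_of_mem_groupJacobian {r : Fin g → ℝ} (hr : ∀ l, 0 ≤ r l) :
    ∃ B : ℝ, ∀ v, ∀ A ∈ groupJacobian G r v, ‖A‖ ≤ B := by
  have : ∀ l, ProperSpace (EuclideanSpace ℝ (G l) →L[ℝ] EuclideanSpace ℝ (G l)) :=
    fun l => FiniteDimensional.proper ℝ _
  have hK : IsCompact (univ.pi fun l => Metric.closedBall
      (0 : EuclideanSpace ℝ (G l) →L[ℝ] EuclideanSpace ℝ (G l)) 1) :=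
    isCompact_univ_pi fun l => isCompact_closedBall _ _
  obtain ⟨B, hB⟩ := (hK.image continuous_residualOp).isBounded.exists_norm_le
  refine ⟨B, fun v A hA => hB A ?_⟩
  refine image_mono (Set.pi_mono fun l _ => ?_) hA
  exact clarkeJacobian_subset_closedBall (lipschitzWith_ballProj (hr l)) _

/-! ### The multifunction `M` -/

theorem surrogateJacobian_eq_image {lam1 lam2 : ℝ} (hlam1 : 0 ≤ lam1) (hlam2 : 0 ≤ lam2)
    {w : Fin g → ℝ} (hw : ∀ l, 0 < w l) (u : EuclideanSpace ℝ (Fin n)) :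
    surrogateJacobian G lam1 lam2 w u =
      (fun q : (∀ l, EuclideanSpace ℝ (G l) →L[ℝ] EuclideanSpace ℝ (G l)) ×
          (EuclideanSpace ℝ (Fin n) →L[ℝ] EuclideanSpace ℝ (Fin n)) =>
          (residualOp G q.1).comp q.2) ''
        ((univ.pi fun l => clarkeJacobian (ballProj (lam2 * w l))
          (restr (G l) (softThreshold lam1 u))) ×ˢ clarkeJacobian (softThreshold lam1) u) := by
  ext M
  simp only [surrogateJacobian, prox_l1Part hlam1,
    fun l => metricProj_closedBall (E := EuclideanSpace ℝ (G l)) (mul_nonneg hlam2 (hw l).le)]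
  constructor
  · rintro ⟨S, hS, Θ, hΘ, rfl⟩
    exact ⟨(S, Θ), ⟨fun l _ => hS l, hΘ⟩, rfl⟩
  · rintro ⟨⟨S, Θ⟩, ⟨hS, hΘ⟩, rfl⟩
    exact ⟨S, fun l => hS l (mem_univ l), Θ, hΘ, rfl⟩

theorem continuous_residualOp_comp : Continuous
    fun q : (∀ l, EuclideanSpace ℝ (G l) →L[ℝ] EuclideanSpace ℝ (G l)) ×
      (EuclideanSpace ℝ (Fin n) →L[ℝ] EuclideanSpace ℝ (Fin n)) =>
      (residualOp G q.1).comp q.2 :=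
  (continuous_residualOp.comp continuous_fst).clm_comp continuous_snd

theorem surrogateJacobian_nonempty {lam1 lam2 : ℝ} (hlam1 : 0 ≤ lam1) (hlam2 : 0 ≤ lam2)
    {w : Fin g → ℝ} (hw : ∀ l, 0 < w l) (u : EuclideanSpace ℝ (Fin n)) :
    (surrogateJacobian G lam1 lam2 w u).Nonempty := by
  rw [surrogateJacobian_eq_image hlam1 hlam2 hw]
  refine Nonempty.image _ (Nonempty.prod (univ_pi_nonempty_iff.2 fun l => ?_) ?_)
  · exact (bSubdifferential_nonempty
      (lipschitzWith_ballProj (mul_nonneg hlam2 (hw l).le)) _).convexHull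
  · exact (bSubdifferential_nonempty (lipschitzWith_softThreshold hlam1) u).convexHull

theorem isCompact_surrogateJacobian {lam1 lam2 : ℝ} (hlam1 : 0 ≤ lam1) (hlam2 : 0 ≤ lam2)
    {w : Fin g → ℝ} (hw : ∀ l, 0 < w l) (u : EuclideanSpace ℝ (Fin n)) :
    IsCompact (surrogateJacobian G lam1 lam2 w u) := by
  rw [surrogateJacobian_eq_image hlam1 hlam2 hw]
  exact ((isCompact_univ_pi fun l =>
    isCompact_clarkeJacobian_ballProj (mul_nonneg hlam2 (hw l).le) _).prod
      (isCompact_clarkeJacobian_softThreshold hlam1 u)).image continuous_residualOp_comp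

theorem upperHemicontinuous_surrogateJacobian {lam1 lam2 : ℝ} (hlam1 : 0 ≤ lam1)
    (hlam2 : 0 ≤ lam2) {w : Fin g → ℝ} (hw : ∀ l, 0 < w l) :
    UpperHemicontinuous (surrogateJacobian G lam1 lam2 w) := by
  have hr : ∀ l, 0 ≤ lam2 * w l := fun l => mul_nonneg hlam2 (hw l).le
  have p1 : ∀ l, ProperSpace (EuclideanSpace ℝ (G l) →L[ℝ] EuclideanSpace ℝ (G l)) :=
    fun l => FiniteDimensional.proper ℝ _
  have p2 : ProperSpace (EuclideanSpace ℝ (Fin n) →L[ℝ] EuclideanSpace ℝ (Fin n)) :=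
    FiniteDimensional.proper ℝ _
  have hK : IsCompact ((univ.pi fun l => Metric.closedBall
      (0 : EuclideanSpace ℝ (G l) →L[ℝ] EuclideanSpace ℝ (G l)) 1) ×ˢ
      Metric.closedBall (0 : EuclideanSpace ℝ (Fin n) →L[ℝ] EuclideanSpace ℝ (Fin n)) 1) :=
    (isCompact_univ_pi fun l => isCompact_closedBall _ _).prod (isCompact_closedBall _ _)
  rw [funext fun u => surrogateJacobian_eq_image (G := G) hlam1 hlam2 hw u]
  refine upperHemicontinuous_image hK (fun u => ?_) ?_ continuous_residualOp_comp
  · exact prod_mono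
      (Set.pi_mono fun l _ => clarkeJacobian_subset_closedBall (lipschitzWith_ballProj (hr l)) _)
      (clarkeJacobian_subset_closedBall (lipschitzWith_softThreshold hlam1) u)
  · intro u u₀ hu q hq q₀ hlim
    refine ⟨fun l _ => ?_, ?_⟩
    · have hv : Tendsto (fun k => restr (G l) (softThreshold lam1 (u k))) atTop
          (𝓝 (restr (G l) (softThreshold lam1 u₀))) :=
        (((restr (G l)).continuous.comp
          (lipschitzWith_softThreshold hlam1).continuous).tendsto u₀).comp hu
      have hS : Tendsto (fun k => (q k).1 l) atTop (𝓝 (q₀.1 l)) :=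
        (((continuous_apply l).comp continuous_fst).tendsto q₀).comp hlim
      exact ((upperHemicontinuous_clarkeJacobian (lipschitzWith_ballProj (hr l))
        (isCompact_clarkeJacobian_ballProj (hr l))).upperHemicontinuousAt _).mem_of_tendsto
        (isCompact_clarkeJacobian_ballProj (hr l) _).isClosed hv
        (Frequently.of_forall fun k => (hq k).1 l (mem_univ l)) hS
    · exact ((upperHemicontinuous_clarkeJacobian (lipschitzWith_softThreshold hlam1)
        (isCompact_clarkeJacobian_softThreshold hlam1)).upperHemicontinuousAt _).mem_of_tendsto
        (isCompact_clarkeJacobian_softThreshold hlam1 _).isClosed hu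
        (Frequently.of_forall fun k => (hq k).2) ((continuous_snd.tendsto q₀).comp hlim)

theorem isPositive_of_mem_surrogateJacobian (hdisj : ∀ i j, i ≠ j → Disjoint (G i) (G j))
    (hcover : ∀ k : Fin n, ∃ l, k ∈ G l) {lam1 lam2 : ℝ} (hlam1 : 0 ≤ lam1) (hlam2 : 0 ≤ lam2)
    {w : Fin g → ℝ} (hw : ∀ l, 0 < w l) {u : EuclideanSpace ℝ (Fin n)}
    {M : EuclideanSpace ℝ (Fin n) →L[ℝ] EuclideanSpace ℝ (Fin n)}
    (hM : M ∈ surrogateJacobian G lam1 lam2 w u) : M.IsPositive := by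
  rw [surrogateJacobian_eq_image hlam1 hlam2 hw] at hM
  obtain ⟨⟨S, Θ⟩, ⟨hS, hΘ⟩, rfl⟩ := hM
  obtain ⟨θ, hθ, hθ'⟩ := exists_diagOp_of_mem_clarkeJacobian hlam1 hΘ
  simp only at hθ
  simp only [hθ]
  exact isPositive_residualOp_comp_diagOp hdisj hcover (fun l => mul_nonneg hlam2 (hw l).le)
    (fun l => hS l (mem_univ l)) hθ'

theorem stronglySemismooth_prox_regularizer (hdisj : ∀ i j, i ≠ j → Disjoint (G i) (G j))
    (hcover : ∀ k : Fin n, ∃ l, k ∈ G l) {lam1 lam2 : ℝ} (hlam1 : 0 ≤ lam1) (hlam2 : 0 ≤ lam2)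
    {w : Fin g → ℝ} (hw : ∀ l, 0 < w l) :
    StronglySemismooth (prox (regularizer G lam1 lam2 w)) (surrogateJacobian G lam1 lam2 w) := by
  have hr : ∀ l, 0 ≤ lam2 * w l := fun l => mul_nonneg hlam2 (hw l).le
  have hlip := lipschitzWith_groupProx hdisj hcover hr
  have hsoft := lipschitzWith_softThreshold (n := n) hlam1
  rw [prox_regularizer hdisj hcover hlam1 hlam2 hw]
  refine ⟨(hlip.comp hsoft).locallyLipschitz, ?_, fun u => ?_⟩
  · exact (dirDifferentiable_groupProx hr).comp hlip (dirDifferentiable_softThreshold hlam1)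
  · obtain ⟨B, hB⟩ := exists_norm_le_of_mem_groupJacobian (G := G) hr
    obtain ⟨C, hC⟩ := QuadraticModelAt.comp hsoft hB (quadraticModelAt_softThreshold hlam1 u)
      (quadraticModelAt_groupProx hr (softThreshold lam1 u))
    obtain ⟨δ, hδ, h⟩ := Metric.eventually_nhds_iff.1 hC
    refine ⟨C, δ, hδ, fun w' hw' M hM => h (by rwa [dist_eq_norm]) M ?_⟩
    rw [surrogateJacobian_eq_image hlam1 hlam2 hw] at hM
    obtain ⟨⟨S, Θ⟩, ⟨hS, hΘ⟩, rfl⟩ := hM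
    exact ⟨residualOp G S, ⟨S, hS, rfl⟩, Θ, hΘ, rfl⟩

end Groups

end SGLasso

theorem theorem3p1 {n g : ℕ} (G : Fin g → Finset (Fin n))
    (hdisj : ∀ i j, i ≠ j → Disjoint (G i) (G j))
    (hcover : ∀ k : Fin n, ∃ l, k ∈ G l)
    (lam1 lam2 : ℝ) (hlam1 : 0 ≤ lam1) (hlam2 : 0 ≤ lam2)
    (w : Fin g → ℝ) (hw : ∀ l, 0 < w l) :
    (∀ u, (SGLasso.surrogateJacobian G lam1 lam2 w u).Nonempty ∧
      IsCompact (SGLasso.surrogateJacobian G lam1 lam2 w u)) ∧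
    UpperHemicontinuous (SGLasso.surrogateJacobian G lam1 lam2 w) ∧
    (∀ u, ∀ M ∈ SGLasso.surrogateJacobian G lam1 lam2 w u, M.IsPositive) ∧
    StronglySemismooth (prox (SGLasso.regularizer G lam1 lam2 w))
      (SGLasso.surrogateJacobian G lam1 lam2 w) :=
  ⟨fun u => ⟨SGLasso.surrogateJacobian_nonempty hlam1 hlam2 hw u,
    SGLasso.isCompact_surrogateJacobian hlam1 hlam2 hw u⟩,
    SGLasso.upperHemicontinuous_surrogateJacobian hlam1 hlam2 hw,
    fun _ _ hM => SGLasso.isPositive_of_mem_surrogateJacobian hdisj hcover hlam1 hlam2 hw hM,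
    SGLasso.stronglySemismooth_prox_regularizer hdisj hcover hlam1 hlam2 hw⟩
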